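/- Let $m\ge 2$ be an integer. In the $m$-user symmetric binary-deterministic random access channel (RAC), the set $A\subseteq\{1,\dots,m\}$ of active users is known to the receiver, while each user only knows whether it is active itself; the inputs are bits, and when $A$ is active the receiver observes, at each time $t$, the noise-free output $Y_{A,t}=\sum_{a\in A}X_{a,t}$ over $\mathrm{GF}(2)$. A *message structure* $\mathscr W$ gives each user $i$ a finite set $\mathcal W_i$ of messages $W_{i,j}$ and, for $i\in A$, a subset $\mathcal W_i(A)\subseteq\mathcal W_i$ of messages to be decoded in state $A$, with $\mathcal W_i(B)\subseteq\mathcal W_i(A)$ whenever $i\in A\subseteq B$. All messages are independent, $W_{i,j}$ being uniform on a set of $\lceil 2^{nR_{i,j}}\rceil$ elements, $R_{i,j}\ge 0$. An $n$-code consists of encoders mapping the messages of user $i$ to a codeword in $\{0,1\}^n$ and, for each $A$, a decoder mapping the output sequence $\mathbf Y_A$ to estimates of the messages in $\mathcal W_i(A)$, $i\in A$. The tuple $r_i(A)=\sum_{j:\,W_{i,j}\in\mathcal W_i(A)}R_{i,j}$ ($i\in A$) is *achievable* for $\mathscr W$ if there are $n$-codes for which, for every $A$, the probability that some estimate at decoder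 $A$ is wrong tends to $0$ as $n\to\infty$. The region $\mathcal C_{\mathscr W}$ is the closure of the set of achievable tuples, the capacity region is $\mathcal C=\mathrm{closure}\bigl(\bigcup_{\mathscr W}\mathcal C_{\mathscr W}\bigr)$, and for $p\in[0,1]$ the throughput is $$T(p,m)=\max_{(r_i(A))\in\mathcal C}\ \sum_{A\subseteq\{1,\dots,m\}}p^{|A|}(1-p)^{m-|A|}\sum_{i\in A}r_i(A).$$ Let $F_{n,k}(p)=\sum_{i=0}^{k}\binom ni p^i(1-p)^{n-i}$. **Theorem.** For each $0<k<m$ the equation $$\frac1{k+1}F_{m-1,k}(p)=\frac1kF_{m-1,k-1}(p)$$ has a unique solution $p_k$ in $(0,1)$. With $p_0=0$ and $p_m=1$ one has $p_0<p_1<\dots<p_m$, so that the intervals $(p_{k-1},p_k]$, $1\le k\le m$, partition $(0,1]$, and: 1. $p_1=\frac1m$, $p_{m-1}=\frac1{m^{1/(m-1)}}$, and $p_k\in\bigl(0,\frac km\bigr)$ for $2\le k\le m-1$. 2. The maximum defining $T(p,m)$ is attained for every $p\in[0,1]$, and for $k\in\{1,\dots,m\}$, $$T(p,m)=\frac{mp}{k}F_{m-1,k-1}(p)\qquad\text{if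 }p\in(p_{k-1},p_k].$$ 3. If $p\in(p_{k-1},p_k]$, then $T(p,m)$ is achieved when every active user sends a single message encoded at rate $\frac1k$, which is decoded when at most $k$ users are active: for the message structure with one message per user, decoded in state $A$ if and only if $|A|\le k$, the rate tuple $r_i(A)=\frac1k$ for $|A|\le k$, $r_i(A)=0$ for $|A|>k$, belongs to $\mathcal C_{\mathscr W}$, and its expected sum-rate equals $T(p,m)$. 4. $T(\cdot,m)$ is continuous on $[0,1]$, and it is concave and strictly increasing on each interval $(p_{k-1},p_k]$, $1\le k\le m$. -/

import Mathlib

open Set Filter Topology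

noncomputable section

namespace BDRAC

/-! ### Binomial probabilities -/

/-- Probability of exactly `k` successes in `n` independent trials with success probability `p`. -/
def binomProb (n k : ℕ) (p : ℝ) : ℝ :=
  (n.choose k : ℝ) * p ^ k * (1 - p) ^ (n - k)

/-- Probability of at most `k` successes in `n` independent trials with success probability `p`. -/
def binomCDF (n k : ℕ) (p : ℝ) : ℝ :=
  ∑ i ∈ Finset.range (k + 1), binomProb n i p

/-! ### The random access channel: message structures and rate tuples -/

/-- The pairs `(i, A)` with `i ∈ A ⊆ {1, …, m}`: an active user together with the channel state. -/
abbrev ActiveUser (m : ℕ) : Type :=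
  {x : Fin m × Finset (Fin m) // x.1 ∈ x.2}

/-- Rate tuples `(r_i(A))`, one real number for each pair `i ∈ A ⊆ {1, …, m}`. -/
abbrev RateTuple (m : ℕ) : Type := ActiveUser m → ℝ

/-- A message structure for an `m`-user random access channel: user `i` has `numMsg i` independent
messages, and `decoded (i, A)` is the set of messages of user `i` that are decoded when `A` is the
set of active users. Whatever is decoded in state `B` is decoded in every smaller state `A ⊆ B`. -/
structure MessageStructure (m : ℕ) where
  numMsg : Fin m → ℕ
  decoded : ∀ x : ActiveUser m, Finset (Fin (numMsg x.1.1))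
  decoded_subset : ∀ (i : Fin m) (A B : Finset (Fin m)) (hi : i ∈ A) (hAB : A ⊆ B),
    decoded ⟨(i, B), hAB hi⟩ ⊆ decoded ⟨(i, A), hi⟩

/-- Rates `R_{i,j}` of the individual messages. -/
abbrev MessageRates {m : ℕ} (W : MessageStructure m) : Type :=
  ∀ i : Fin m, Fin (W.numMsg i) → ℝ

/-- The rate `r_i(A)`: the sum of the rates of the messages of user `i` decoded in state `A`. -/
def rateTuple {m : ℕ} (W : MessageStructure m) (R : MessageRates W) : RateTuple m :=
  fun x => ∑ j ∈ W.decoded x, R x.1.1 j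

/-- The number `⌈2 ^ (n R)⌉` of values of a message of rate `R` at block length `n`. -/
def msgCard (n : ℕ) (R : ℝ) : ℕ := ⌈(2 : ℝ) ^ ((n : ℝ) * R)⌉₊

/-- The possible values of the tuple of all messages of user `i` at block length `n`. -/
abbrev UserMessages {m : ℕ} (W : MessageStructure m) (R : MessageRates W) (n : ℕ) (i : Fin m) :
    Type :=
  ∀ j : Fin (W.numMsg i), Fin (msgCard n (R i j))

/-- An `n`-code for the symmetric binary-deterministic channel. Encoder `i` maps the messages of
user `i` to a binary codeword of length `n`; decoder `A` maps the output sequence of receiver `A`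
to estimates of the messages. Only the estimates of messages that are to be decoded in state `A`
matter (see `errorProb`); all others are ignored. -/
structure Code {m : ℕ} (W : MessageStructure m) (R : MessageRates W) (n : ℕ) where
  enc : ∀ i : Fin m, UserMessages W R n i → (Fin n → ZMod 2)
  dec : Finset (Fin m) → (Fin n → ZMod 2) → ∀ i : Fin m, UserMessages W R n i

/-- The output at receiver `A` of the noise-free symmetric channel: the sum over `GF(2)`, at each
time, of the symbols transmitted by the users in `A`. -/
def Code.output {m : ℕ} {W : MessageStructure m} {R : MessageRates W} {n : ℕ}
    (c : Code W R n) (A : Finset (Fin m)) (w : ∀ i, UserMessages W R n i) : Fin n → ZMod 2 :=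
  fun t => ∑ i ∈ A, c.enc i (w i) t

/-- The average probability of error at receiver `A`, all messages being independent and uniform:
the fraction of the values of the family of all messages for which the estimate of some message
that is to be decoded in state `A` is wrong. -/
def Code.errorProb {m : ℕ} {W : MessageStructure m} {R : MessageRates W} {n : ℕ}
    (c : Code W R n) (A : Finset (Fin m)) : ℝ :=
  (Nat.card {w : ∀ i, UserMessages W R n i //
      ∃ (i : Fin m) (hi : i ∈ A), ∃ j ∈ W.decoded ⟨(i, A), hi⟩,
        c.dec A (c.output A w) i j ≠ w i j} : ℝ) /
    (Nat.card (∀ i, UserMessages W R n i) : ℝ)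

/-- A rate tuple is achievable for `W` if it is the rate tuple of some non-negative message rates
for which there are `n`-codes whose error probability at every receiver tends to `0`. -/
def Achievable {m : ℕ} (W : MessageStructure m) (r : RateTuple m) : Prop :=
  ∃ R : MessageRates W, (∀ i j, 0 ≤ R i j) ∧ rateTuple W R = r ∧
    ∃ c : ∀ n : ℕ, Code W R n,
      ∀ A : Finset (Fin m), Tendsto (fun n => (c n).errorProb A) atTop (𝓝 0)

/-- The capacity region of the channel for the message structure `W`. -/
def capacityRegionOf {m : ℕ} (W : MessageStructure m) : Set (RateTuple m) :=
  closure {r | Achievable W r}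

/-- The capacity region of the `m`-user symmetric binary-deterministic channel. -/
def capacityRegion (m : ℕ) : Set (RateTuple m) :=
  closure (⋃ W : MessageStructure m, capacityRegionOf W)

/-! ### Throughput -/

/-- The expected sum-rate of a rate tuple when every user is active with probability `p`,
independently of the others. -/
def expectedSumRate {m : ℕ} (p : ℝ) (r : RateTuple m) : ℝ :=
  ∑ A : Finset (Fin m), p ^ A.card * (1 - p) ^ (m - A.card) *
    ∑ i : {i : Fin m // i ∈ A}, r ⟨(i.1, A), i.2⟩

/-- The throughput: the supremum of the expected sum-rate over the capacity region. -/
def throughput (m : ℕ) (p : ℝ) : ℝ :=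
  sSup (expectedSumRate p '' capacityRegion m)

/-- The message structure in which every user has a single message, which is decoded when at most
`k` users are active. -/
def singleMessage (m k : ℕ) : MessageStructure m where
  numMsg := fun _ => 1
  decoded := fun x => if x.1.2.card ≤ k then Finset.univ else ∅
  decoded_subset := by
    intro i A B hi hAB
    have h := Finset.card_le_card hAB
    dsimp only
    split_ifs with h1 h2
    · exact subset_rfl
    · exact absurd (h.trans h1) h2
    · exact Finset.empty_subset _
    · exact subset_rfl

/-- The rates at which every single message is encoded at the same rate `R`. -/
def singleRate (m k : ℕ) (R : ℝ) : MessageRates (singleMessage m k) := fun _ _ => R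

/-- `x` is a solution in `(0, 1)` of the equation
`F_{m-1,k}(x) / (k + 1) = F_{m-1,k-1}(x) / k`. -/
def IsThreshold (m k : ℕ) (x : ℝ) : Prop :=
  x ∈ Ioo (0 : ℝ) 1 ∧
    1 / ((k : ℝ) + 1) * binomCDF (m - 1) k x = 1 / (k : ℝ) * binomCDF (m - 1) (k - 1) x

end BDRAC

end

/-! Write `b_i` for `binomProb (m - 1) i p` and `S_k = b_0 + ⋯ + b_{k-1}`. The heart of the matter
is that the throughput is `m p · max_k S_k / k` over `1 ≤ k ≤ m`.

Converse: order the users by a permutation `σ` and consider the states formed by its prefixes. From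
the sum of all codewords, the decoders of these states peel off the users one at a time, the last
one first. Hence `n` output bits determine all messages decoded along the chain, given the others,
and the corresponding rates sum to at most 1 (`Achievable.chain_sum_le`). Averaging over `σ` leaves
a decreasing non-negative sequence `ρ` of sum at most 1 and the objective `m p ∑ b_k ρ_k`
(`card_perm_mul_expectedSumRate`, `positionSum_succ_le`). Such a linear functional is bounded by its
values on the uniform weights on initial segments, which give `S_k / k` (`sum_mul_le_of_antitone`).

Achievability: a Reed–Solomon code over the field with `2 ^ L` elements, `L = ⌊n / k⌋`, lets every
set of at most `k` users be decoded without error from the sum (`exists_sum_separating_enc`).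

Choice of `k`: passing from `k` to `k + 1` helps exactly when the gap `k b_k - S_k` is positive. By
monotone likelihood ratios it changes sign only once in `p` (`binomGap_pos_of_lt`), and the zeros
increase with `k` (`threshold_lt_succ`), so `S_k / k` is unimodal in `k` with its peak at the
asserted place. The gap is also minus the derivative of `p S_k`, which gives monotonicity; concavity
follows since `p_k ≤ k / m` lies below the point where `b_{k+1}` overtakes `b_k`. -/

namespace BDRAC

/-! ### Partial sums of binomial probabilities -/

/-- Probability of fewer than `k` successes in `n` independent trials. -/
noncomputable def binomSum (n k : ℕ) (p : ℝ) : ℝ := ∑ i ∈ Finset.range k, binomProb n i p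

/-- The function `p ↦ k b_k(p) - (b_0(p) + ⋯ + b_{k-1}(p))`, whose zeros in `(0, 1)` are the
thresholds. -/
noncomputable def binomGap (n k : ℕ) (p : ℝ) : ℝ := k * binomProb n k p - binomSum n k p

lemma binomCDF_eq_binomSum (n k : ℕ) (p : ℝ) : binomCDF n k p = binomSum n (k + 1) p := rfl

lemma binomCDF_pred_eq_binomSum (n : ℕ) {k : ℕ} (hk : 0 < k) (p : ℝ) :
    binomCDF n (k - 1) p = binomSum n k p := by
  rw [binomCDF_eq_binomSum, Nat.sub_add_cancel hk]

lemma binomSum_succ (n k : ℕ) (p : ℝ) :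
    binomSum n (k + 1) p = binomSum n k p + binomProb n k p :=
  Finset.sum_range_succ _ _

lemma binomGap_succ (n k : ℕ) (p : ℝ) :
    binomGap n (k + 1) p
      = binomGap n k p + (k + 1) * (binomProb n (k + 1) p - binomProb n k p) := by
  simp only [binomGap, binomSum_succ]
  push_cast
  ring

lemma isThreshold_iff {m k : ℕ} (hk : 0 < k) (x : ℝ) :
    IsThreshold m k x ↔ x ∈ Ioo (0 : ℝ) 1 ∧ binomGap (m - 1) k x = 0 := by
  have hk' : (0 : ℝ) < k := by exact_mod_cast hk
  rw [IsThreshold, binomCDF_pred_eq_binomSum _ hk, binomCDF_eq_binomSum, binomSum_succ, binomGap]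
  refine and_congr_right fun _ => ?_
  field_simp
  constructor <;> intro h <;> linarith

lemma binomProb_nonneg (n k : ℕ) {p : ℝ} (hp : p ∈ Icc (0 : ℝ) 1) : 0 ≤ binomProb n k p := by
  have h0 := hp.1
  have h1 : 0 ≤ 1 - p := sub_nonneg.2 hp.2
  unfold binomProb
  positivity

lemma binomProb_pos {n k : ℕ} (hk : k ≤ n) {p : ℝ} (hp : p ∈ Ioo (0 : ℝ) 1) :
    0 < binomProb n k p := by
  have h0 := hp.1
  have h1 : 0 < 1 - p := sub_pos.2 hp.2
  have h2 : 0 < n.choose k := Nat.choose_pos hk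
  unfold binomProb
  positivity

@[fun_prop]
lemma continuous_binomProb (n k : ℕ) : Continuous (binomProb n k) := by
  unfold binomProb
  fun_prop

@[fun_prop]
lemma continuous_binomSum (n k : ℕ) : Continuous (binomSum n k) :=
  continuous_finsetSum _ fun i _ => continuous_binomProb n i

@[fun_prop]
lemma continuous_binomGap (n k : ℕ) : Continuous (binomGap n k) := by
  unfold binomGap
  fun_prop

lemma binomSum_self_succ (n : ℕ) (p : ℝ) : binomSum n (n + 1) p = 1 := by
  have h := add_pow p (1 - p) n
  rw [add_sub_cancel, one_pow] at h
  rw [h]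
  refine Finset.sum_congr rfl fun i _ => ?_
  unfold binomProb
  ring

/-- Consecutive binomial probabilities. -/
lemma binomProb_succ_mul (n k : ℕ) (p : ℝ) :
    (k + 1) * ((1 - p) * binomProb n (k + 1) p) = (n - k) * (p * binomProb n k p) := by
  rcases lt_trichotomy k n with h | rfl | h
  · obtain ⟨d, rfl⟩ := Nat.exists_eq_add_of_lt h
    have hc : ((k + d + 1).choose (k + 1) : ℝ) * (k + 1) = (k + d + 1).choose k * (d + 1) := by
      have := Nat.choose_succ_right_eq (k + d + 1) k
      rw [show k + d + 1 - k = d + 1 by omega] at this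
      exact_mod_cast this
    simp only [binomProb]
    rw [show k + d + 1 - k = d + 1 by omega, show k + d + 1 - (k + 1) = d by omega]
    push_cast
    linear_combination (1 - p) * p ^ (k + 1) * (1 - p) ^ d * hc
  · simp [binomProb]
  · simp [binomProb, Nat.choose_eq_zero_of_lt h, Nat.choose_eq_zero_of_lt (h.trans k.lt_succ_self)]

/-- Locates the mode: for `0 < p < 1` and `k ≤ n`, the step from `k` to `k + 1` goes up or down
according to the sign of `(n + 1) p - (k + 1)`. -/
lemma binomProb_succ_sub (n k : ℕ) (p : ℝ) :
    (k + 1) * ((1 - p) * (binomProb n (k + 1) p - binomProb n k p))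
      = ((n + 1) * p - (k + 1)) * binomProb n k p := by
  linear_combination binomProb_succ_mul n k p

lemma binomProb_succ_lt {n k : ℕ} (hk : k ≤ n) {p : ℝ} (hp : p ∈ Ioo (0 : ℝ) 1)
    (h : (n + 1) * p < k + 1) : binomProb n (k + 1) p < binomProb n k p := by
  have h1 : 0 < (k + 1 : ℝ) * (1 - p) := mul_pos (by positivity) (sub_pos.2 hp.2)
  have h2 := binomProb_succ_sub n k p
  have h3 := mul_neg_of_neg_of_pos (sub_neg.2 h) (binomProb_pos hk hp)
  rw [← h2, ← mul_assoc] at h3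
  exact sub_neg.1 (not_le.1 fun h => h3.not_ge (mul_nonneg h1.le h))

lemma binomProb_lt_succ {n k : ℕ} (hk : k ≤ n) {p : ℝ} (hp : p ∈ Ioo (0 : ℝ) 1)
    (h : k + 1 < (n + 1) * p) : binomProb n k p < binomProb n (k + 1) p := by
  have h1 : 0 < (k + 1 : ℝ) * (1 - p) := mul_pos (by positivity) (sub_pos.2 hp.2)
  have h2 := binomProb_succ_sub n k p
  have h3 := mul_pos (sub_pos.2 h) (binomProb_pos hk hp)
  rw [← h2, ← mul_assoc] at h3
  exact sub_pos.1 ((mul_pos_iff_of_pos_left h1).1 h3)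

lemma binomProb_le_succ {n k : ℕ} {p : ℝ} (hp : p ∈ Ioo (0 : ℝ) 1)
    (h : k + 1 ≤ (n + 1) * p) : binomProb n k p ≤ binomProb n (k + 1) p := by
  have h1 : 0 < (k + 1 : ℝ) * (1 - p) := mul_pos (by positivity) (sub_pos.2 hp.2)
  have h2 := binomProb_succ_sub n k p
  have h3 := mul_nonneg (sub_nonneg.2 h) (binomProb_nonneg n k ⟨hp.1.le, hp.2.le⟩)
  rw [← h2, ← mul_assoc] at h3
  exact sub_nonneg.1 (nonneg_of_mul_nonneg_right h3 h1)

lemma binomProb_succ_le {n k : ℕ} {p : ℝ} (hp : p ∈ Ioo (0 : ℝ) 1)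
    (h : (n + 1) * p ≤ k + 1) : binomProb n (k + 1) p ≤ binomProb n k p := by
  have h1 : 0 < (k + 1 : ℝ) * (1 - p) := mul_pos (by positivity) (sub_pos.2 hp.2)
  have h2 := binomProb_succ_sub n k p
  have h3 := mul_nonpos_of_nonpos_of_nonneg (sub_nonpos.2 h)
    (binomProb_nonneg n k ⟨hp.1.le, hp.2.le⟩)
  rw [← h2, ← mul_assoc] at h3
  exact sub_nonpos.1 (nonpos_of_mul_nonpos_right h3 h1)

/-! ### The sign of the gap -/

lemma binomProb_le_of_le {n k i : ℕ} {p : ℝ} (hp : p ∈ Ioo (0 : ℝ) 1)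
    (h : k ≤ (n + 1) * p) (hik : i ≤ k) : binomProb n i p ≤ binomProb n k p := by
  induction k, hik using Nat.le_induction with
  | base => exact le_rfl
  | succ j hj ih =>
    push_cast at h
    exact (ih (by linarith)).trans (binomProb_le_succ hp h)

/-- Below the mode the probabilities increase, so each of the `k` terms of the partial sum is at
most the `k`-th probability. -/
lemma binomGap_nonneg_of_le {n k : ℕ} {p : ℝ} (hp : p ∈ Ioo (0 : ℝ) 1)
    (h : k ≤ (n + 1) * p) : 0 ≤ binomGap n k p := by
  have : binomSum n k p ≤ ∑ _i ∈ Finset.range k, binomProb n k p :=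
    Finset.sum_le_sum fun i hi => binomProb_le_of_le hp h (Finset.mem_range.1 hi).le
  rw [Finset.sum_const, Finset.card_range, nsmul_eq_mul] at this
  exact sub_nonneg.2 this

lemma binomGap_pos_of_le {n k : ℕ} (hk : 2 ≤ k) {p : ℝ} (hp : p ∈ Ioo (0 : ℝ) 1)
    (h : k ≤ (n + 1) * p) : 0 < binomGap n k p := by
  have hk' : (2 : ℝ) ≤ k := by exact_mod_cast hk
  have : binomSum n k p < ∑ _i ∈ Finset.range k, binomProb n k p := by
    -- Strictness comes from the term `i = 0`: as `2 ≤ k`, already the step from 0 to 1 is strict.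
    -- For `k = 1` equality can occur.
    refine Finset.sum_lt_sum
      (fun i hi => binomProb_le_of_le hp h (Finset.mem_range.1 hi).le) ⟨0, by simp; omega, ?_⟩
    refine (binomProb_lt_succ (Nat.zero_le n) hp ?_).trans_le
      (binomProb_le_of_le hp h (by omega))
    push_cast
    linarith
  rw [Finset.sum_const, Finset.card_range, nsmul_eq_mul] at this
  exact sub_pos.2 this

/-- Monotone likelihood ratio, cross-multiplied: the ratio of the `k`-th to the `i`-th probability
is a constant times `(p / (1 - p)) ^ (k - i)`. -/
lemma binomProb_mul_lt {n k i : ℕ} (hik : i < k) (hkn : k ≤ n) {p x : ℝ} (hp : 0 < p)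
    (hpx : p < x) (hx : x < 1) :
    binomProb n i x * binomProb n k p < binomProb n k x * binomProb n i p := by
  obtain ⟨d, rfl⟩ := Nat.exists_eq_add_of_lt hik
  obtain ⟨e, rfl⟩ := Nat.exists_eq_add_of_le hkn
  have hx0 : 0 < x := hp.trans hpx
  have hp1 : 0 < 1 - p := by linarith
  have hx1 : 0 < 1 - x := by linarith
  have key : ((1 - x) * p) ^ (d + 1) < (x * (1 - p)) ^ (d + 1) :=
    pow_lt_pow_left₀ (by nlinarith) (by positivity) (by omega)
  have hc1 : 0 < (i + d + 1 + e).choose i := Nat.choose_pos (by omega)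
  have hc2 : 0 < (i + d + 1 + e).choose (i + d + 1) := Nat.choose_pos (by omega)
  have hc : 0 < ((i + d + 1 + e).choose i : ℝ) * (i + d + 1 + e).choose (i + d + 1)
      * (x * p) ^ i * ((1 - x) * (1 - p)) ^ e := by positivity
  have := mul_lt_mul_of_pos_left key hc
  simp only [binomProb]
  rw [show i + d + 1 + e - i = (d + 1) + e by omega,
    show i + d + 1 + e - (i + d + 1) = e by omega, show i + d + 1 = i + (d + 1) by omega]
  rw [show i + d + 1 = i + (d + 1) by omega] at this
  simp only [mul_pow] at this
  linear_combination this

/-- Once the gap is non-negative, it is positive from there on. -/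
lemma binomGap_pos_of_lt {n k : ℕ} (hk : 0 < k) (hkn : k ≤ n) {p x : ℝ} (hp : 0 < p)
    (hpx : p < x) (hx : x < 1) (h : 0 ≤ binomGap n k p) : 0 < binomGap n k x := by
  have hb := binomProb_pos hkn ⟨hp, hpx.trans hx⟩
  have hbx := binomProb_pos hkn ⟨hp.trans hpx, hx⟩
  -- Summing over `i < k` shows that the partial sum divided by the `k`-th probability strictly
  -- decreases in `p`; the gap compares this ratio with `k`.
  have h1 : binomSum n k x * binomProb n k p < binomProb n k x * binomSum n k p := by
    unfold binomSum
    rw [Finset.sum_mul, Finset.mul_sum]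
    refine Finset.sum_lt_sum_of_nonempty ⟨0, Finset.mem_range.2 hk⟩ fun i hi => ?_
    exact binomProb_mul_lt (Finset.mem_range.1 hi) hkn hp hpx hx
  have h2 := mul_le_mul_of_nonneg_left (sub_nonneg.1 h) hbx.le
  have h3 : binomSum n k x * binomProb n k p < (k * binomProb n k x) * binomProb n k p := by
    linarith
  exact sub_pos.2 (lt_of_mul_lt_mul_right h3 hb.le)

lemma binomGap_zero_right {n k : ℕ} (hk : 0 < k) : binomGap n k 0 = -1 := by
  have h : ∀ i ≠ 0, binomProb n i 0 = 0 := fun i hi => by simp [binomProb, hi]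
  rw [binomGap, h k hk.ne', binomSum, Finset.sum_eq_single 0 (fun i _ hi => h i hi)
    (fun h => absurd (Finset.mem_range.2 hk) h)]
  simp [binomProb]

lemma binomGap_one_right_nonneg {n k : ℕ} (hkn : k ≤ n) : 0 ≤ binomGap n k 1 := by
  have : binomSum n k 1 = 0 := by
    refine Finset.sum_eq_zero fun i hi => ?_
    have : n - i ≠ 0 := by have := Finset.mem_range.1 hi; omega
    simp [binomProb, this]
  rw [binomGap, this, sub_zero]
  exact mul_nonneg (Nat.cast_nonneg k) (binomProb_nonneg n k ⟨zero_le_one, le_rfl⟩)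

lemma binomGap_neg_of_lt_threshold {n k : ℕ} (hk : 0 < k) (hkn : k ≤ n) {x p : ℝ}
    (hx : x ∈ Ioo (0 : ℝ) 1) (h : binomGap n k x = 0) (hp : 0 ≤ p) (hpx : p < x) :
    binomGap n k p < 0 := by
  rcases hp.eq_or_lt with rfl | hp
  · rw [binomGap_zero_right hk]; norm_num
  · by_contra! hc
    exact (binomGap_pos_of_lt hk hkn hp hpx hx.2 hc).ne' h

lemma binomGap_nonneg_of_threshold_le {n k : ℕ} (hk : 0 < k) (hkn : k ≤ n) {x p : ℝ}
    (hx : x ∈ Ioo (0 : ℝ) 1) (h : binomGap n k x = 0) (hxp : x ≤ p) (hp : p ≤ 1) :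
    0 ≤ binomGap n k p := by
  rcases hp.eq_or_lt with rfl | hp
  · exact binomGap_one_right_nonneg hkn
  · rcases hxp.eq_or_lt with rfl | hxp
    · exact h.ge
    · exact (binomGap_pos_of_lt hk hkn hx.1 hxp hp h.ge).le

/-! ### Thresholds -/

lemma exists_binomGap_eq_zero {n k : ℕ} (hk : 0 < k) (hkn : k ≤ n) :
    ∃ x ∈ Ioo (0 : ℝ) 1, binomGap n k x = 0 := by
  have hk' : (0 : ℝ) < k := by exact_mod_cast hk
  have hkn' : (k : ℝ) ≤ n := by exact_mod_cast hkn
  have hy : (k : ℝ) / (n + 1) ∈ Ioo (0 : ℝ) 1 :=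
    ⟨by positivity, by rw [div_lt_one (by positivity)]; linarith⟩
  have h1 : 0 ≤ binomGap n k (k / (n + 1)) :=
    binomGap_nonneg_of_le hy (by field_simp; exact le_rfl)
  have h0 : binomGap n k 0 < 0 := by rw [binomGap_zero_right hk]; norm_num
  obtain ⟨x, hx, hx'⟩ := intermediate_value_Icc hy.1.le (continuous_binomGap n k).continuousOn
    ⟨h0.le, h1⟩
  refine ⟨x, ⟨lt_of_le_of_ne hx.1 ?_, hx.2.trans_lt hy.2⟩, hx'⟩
  rintro rfl
  exact h0.ne hx'

lemma binomGap_eq_zero_unique {n k : ℕ} (hk : 0 < k) (hkn : k ≤ n) {x y : ℝ}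
    (hx : x ∈ Ioo (0 : ℝ) 1) (hy : y ∈ Ioo (0 : ℝ) 1) (h : binomGap n k x = 0)
    (h' : binomGap n k y = 0) : x = y := by
  rcases lt_trichotomy x y with hlt | rfl | hlt
  · exact absurd h' (binomGap_pos_of_lt hk hkn hx.1 hlt hy.2 h.ge).ne'
  · rfl
  · exact absurd h (binomGap_pos_of_lt hk hkn hy.1 hlt hx.2 h'.ge).ne'

lemma existsUnique_isThreshold {m k : ℕ} (hk : 0 < k) (hkm : k < m) :
    ∃! x : ℝ, IsThreshold m k x := by
  have hkn : k ≤ m - 1 := by omega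
  obtain ⟨x, hx, hx'⟩ := exists_binomGap_eq_zero hk hkn
  refine ⟨x, (isThreshold_iff hk x).2 ⟨hx, hx'⟩, fun y hy => ?_⟩
  have hy' := (isThreshold_iff hk y).1 hy
  exact binomGap_eq_zero_unique hk hkn hy'.1 hx hy'.2 hx'

lemma threshold_mul_le {n k : ℕ} (hk : 0 < k) (hkn : k ≤ n) {x : ℝ}
    (hx : x ∈ Ioo (0 : ℝ) 1) (h : binomGap n k x = 0) : (n + 1) * x ≤ k := by
  have hk' : (0 : ℝ) < k := by exact_mod_cast hk
  by_contra! hc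
  have hlt : (k : ℝ) / (n + 1) < x := by rw [div_lt_iff₀' (by positivity)]; exact hc
  have hpos : 0 < (k : ℝ) / (n + 1) := by positivity
  refine (binomGap_neg_of_lt_threshold hk hkn hx h hpos.le hlt).not_ge
    (binomGap_nonneg_of_le ⟨hpos, hlt.trans hx.2⟩ ?_)
  field_simp
  exact le_rfl

lemma threshold_mul_lt {n k : ℕ} (hk : 2 ≤ k) (hkn : k ≤ n) {x : ℝ}
    (hx : x ∈ Ioo (0 : ℝ) 1) (h : binomGap n k x = 0) : (n + 1) * x < k := by
  refine lt_of_le_of_ne (threshold_mul_le (by omega) hkn hx h) fun hc => ?_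
  exact (binomGap_pos_of_le hk hx hc.ge).ne' h

/-- At the zero `x` of the `k`-th gap, the next gap reduces to `(k + 1) (b_{k+1} - b_k)`. This is
negative because `x ≤ k / (n + 1)`, so the next zero has not yet been reached. -/
lemma threshold_lt_succ {n k : ℕ} (hk : 0 < k) (hkn : k + 1 ≤ n) {x y : ℝ}
    (hx : x ∈ Ioo (0 : ℝ) 1) (hy : y ∈ Ioo (0 : ℝ) 1) (h : binomGap n k x = 0)
    (h' : binomGap n (k + 1) y = 0) : x < y := by
  have h1 : binomGap n (k + 1) x < 0 := by
    rw [binomGap_succ, h, zero_add]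
    have := threshold_mul_le hk (by omega) hx h
    exact mul_neg_of_pos_of_neg (by positivity)
      (sub_neg.2 (binomProb_succ_lt (by omega) hx (by linarith)))
  by_contra! hc
  exact h1.not_ge (binomGap_nonneg_of_threshold_le k.succ_pos hkn hy h' hc hx.2.le)

lemma threshold_one {n : ℕ} {x : ℝ} (hx : x ∈ Ioo (0 : ℝ) 1)
    (h : binomGap n 1 x = 0) : (n + 1) * x = 1 := by
  have h1 := binomProb_succ_sub n 0 x
  have h2 := binomGap_succ n 0 x
  have h3 : binomGap n 0 x = 0 := by simp [binomGap, binomSum]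
  have h4 := binomProb_pos (Nat.zero_le n) hx
  norm_num [h, h3] at h1 h2
  rw [← h2, mul_zero] at h1
  have := (mul_eq_zero.1 h1.symm).resolve_right h4.ne'
  linarith

lemma threshold_self_pow {n : ℕ} {x : ℝ} (h : binomGap n n x = 0) : (n + 1) * x ^ n = 1 := by
  have h1 := binomSum_self_succ n x
  rw [binomSum_succ] at h1
  have h2 : binomProb n n x = x ^ n := by simp [binomProb]
  rw [binomGap] at h
  rw [h2] at h h1
  linarith

/-! ### Derivatives -/

/-- Multiplied by `p`, the derivative is a difference of consecutive terms of one sequence, so sums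
of it telescope. -/
lemma exists_hasDerivAt_binomProb (n k : ℕ) (p : ℝ) :
    ∃ d, HasDerivAt (binomProb n k) d p ∧
      p * d = k * binomProb n k p - (k + 1) * binomProb n (k + 1) p := by
  have hd : HasDerivAt (binomProb n k)
      ((n.choose k : ℝ) * (k * p ^ (k - 1)) * (1 - p) ^ (n - k)
        + (n.choose k : ℝ) * p ^ k * (((n - k : ℕ) : ℝ) * (1 - p) ^ (n - k - 1) * (-1))) p := by
    have h1 := ((hasDerivAt_pow k p).const_mul (n.choose k : ℝ))
    have h2 := ((hasDerivAt_id p).const_sub 1).fun_pow (n - k)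
    exact h1.mul h2
  refine ⟨_, hd, ?_⟩
  have hc : (n.choose (k + 1) : ℝ) * (k + 1) = n.choose k * ((n - k : ℕ) : ℝ) := by
    exact_mod_cast Nat.choose_succ_right_eq n k
  have hk : (k : ℝ) * p ^ (k - 1) * p = k * p ^ k := by
    rcases k.eq_zero_or_pos with rfl | hk
    · simp
    · rw [mul_assoc, ← pow_succ, Nat.sub_add_cancel hk]
  simp only [binomProb]
  rw [show n - (k + 1) = n - k - 1 by omega, pow_succ p k]
  linear_combination (n.choose k : ℝ) * (1 - p) ^ (n - k) * hk
    + p ^ k * p * (1 - p) ^ (n - k - 1) * hc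

lemma hasDerivAt_mul_binomSum (n k : ℕ) (p : ℝ) :
    HasDerivAt (fun x => x * binomSum n k x) (-binomGap n k p) p := by
  induction k with
  | zero => simpa [binomSum, binomGap] using hasDerivAt_const p (0 : ℝ)
  | succ k ih =>
    obtain ⟨d, hd, hd'⟩ := exists_hasDerivAt_binomProb n k p
    have h := ih.add ((hasDerivAt_id p).mul hd)
    have he : (fun x => x * binomSum n (k + 1) x)
        = (fun x => x * binomSum n k x) + id * binomProb n k := by
      funext x
      simp only [binomSum_succ, Pi.add_apply, Pi.mul_apply, id]
      ring
    rw [he]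
    refine h.congr_deriv ?_
    rw [binomGap_succ, id, hd']
    ring

lemma exists_hasDerivAt_binomGap (n k : ℕ) (p : ℝ) :
    ∃ d, HasDerivAt (binomGap n k) d p ∧
      p * d = k * (k + 1) * (binomProb n k p - binomProb n (k + 1) p) := by
  obtain ⟨d, hd, hd'⟩ := exists_hasDerivAt_binomProb n k p
  have hS : ∃ e, HasDerivAt (binomSum n k) e p := by
    refine ⟨_, HasDerivAt.fun_sum fun i _ => (exists_hasDerivAt_binomProb n i p).choose_spec.1⟩
  obtain ⟨e, he⟩ := hS
  -- Uniqueness of the derivative of `p S_k` identifies `p S_k'` without differentiating the sum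
  -- term by term.
  have h1 := ((hasDerivAt_id p).mul he).unique (hasDerivAt_mul_binomSum n k p)
  refine ⟨k * d - e, (hd.const_mul (k : ℝ)).sub he, ?_⟩
  simp only [id, binomGap] at h1
  linear_combination k * hd' - h1

lemma concaveOn_mul_binomSum {n k : ℕ} {D : Set ℝ} (hD : Convex ℝ D)
    (hD' : ∀ x ∈ D, x ∈ Icc (0 : ℝ) 1 ∧ (n + 1) * x ≤ k + 1) :
    ConcaveOn ℝ D (fun x => x * binomSum n k x) := by
  have hint : ∀ x ∈ interior D, x ∈ Ioo (0 : ℝ) 1 ∧ (n + 1) * x ≤ k + 1 := fun x hx => by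
    refine ⟨?_, (hD' x (interior_subset hx)).2⟩
    rw [← interior_Icc]
    exact interior_mono (fun y hy => (hD' y hy).1) hx
  choose d hd using exists_hasDerivAt_binomGap n k
  refine concaveOn_of_hasDerivWithinAt2_nonpos (f' := fun x => -binomGap n k x)
    (f'' := fun x => -d x) hD (by fun_prop)
    (fun x _ => (hasDerivAt_mul_binomSum n k x).hasDerivWithinAt)
    (fun x hx => ((hd x).1.neg).hasDerivWithinAt) fun x hx => ?_
  obtain ⟨hx1, hx2⟩ := hint x hx
  have h1 := (hd x).2
  have h2 : 0 ≤ x * d x := by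
    rw [h1]
    exact mul_nonneg (by positivity) (sub_nonneg.2 (binomProb_succ_le hx1 hx2))
  exact neg_nonpos.2 (nonneg_of_mul_nonneg_right h2 hx1.1)

lemma strictMonoOn_mul_binomSum {n k : ℕ} {D : Set ℝ} (hD : Convex ℝ D)
    (hD' : ∀ x ∈ interior D, binomGap n k x < 0) :
    StrictMonoOn (fun x => x * binomSum n k x) D := by
  refine strictMonoOn_of_deriv_pos hD (by fun_prop) fun x hx => ?_
  rw [(hasDerivAt_mul_binomSum n k x).deriv]
  exact neg_pos.2 (hD' x hx)

/-! ### The converse -/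

/-- The extension of a rate tuple by `0` to the pairs `(i, A)` with `i ∉ A`. -/
noncomputable def extRate {m : ℕ} (r : RateTuple m) (i : Fin m) (A : Finset (Fin m)) : ℝ :=
  if h : i ∈ A then r ⟨(i, A), h⟩ else 0

lemma extRate_of_mem {m : ℕ} (r : RateTuple m) {i : Fin m} {A : Finset (Fin m)} (h : i ∈ A) :
    extRate r i A = r ⟨(i, A), h⟩ := dif_pos h

/-- The set of the first users, up to the one in position `k`, in the order given by `σ`. -/
def prefixSet {m : ℕ} (σ : Equiv.Perm (Fin m)) (k : Fin m) : Finset (Fin m) :=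
  (Finset.Iic k).map σ.toEmbedding

lemma mem_prefixSet {m : ℕ} {σ : Equiv.Perm (Fin m)} {k i : Fin m} :
    i ∈ prefixSet σ k ↔ σ.symm i ≤ k := by
  simp only [prefixSet, Finset.mem_map_equiv, Finset.mem_Iic]

lemma apply_mem_prefixSet {m : ℕ} (σ : Equiv.Perm (Fin m)) (k : Fin m) : σ k ∈ prefixSet σ k := by
  simp [mem_prefixSet]

lemma one_le_msgCard (n : ℕ) (R : ℝ) : 1 ≤ msgCard n R :=
  Nat.one_le_iff_ne_zero.2 (Nat.ceil_pos.2 (by positivity)).ne'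

/-- The messages of user `i` decoded when the active users are those up to `i` in the order
given by `σ`. -/
def chainDecoded {m : ℕ} (W : MessageStructure m) (σ : Equiv.Perm (Fin m)) (i : Fin m) :
    Finset (Fin (W.numMsg i)) :=
  W.decoded ⟨(i, prefixSet σ (σ.symm i)), by simp [mem_prefixSet]⟩

/-- The message tuples for which some receiver makes an error. -/
def Code.badSet {m : ℕ} {W : MessageStructure m} {R : MessageRates W} {n : ℕ}
    (c : Code W R n) : Set (∀ i, UserMessages W R n i) :=
  {w | ∃ A : Finset (Fin m), ∃ (i : Fin m) (hi : i ∈ A), ∃ j ∈ W.decoded ⟨(i, A), hi⟩,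
        c.dec A (c.output A w) i j ≠ w i j}

/-- Successive cancellation: outside of the bad set, the sum of all codewords together with the
messages that are not decoded along a chain of states determines all messages. -/
lemma Code.eq_of_notMem_badSet {m : ℕ} {W : MessageStructure m} {R : MessageRates W} {n : ℕ}
    (c : Code W R n) (σ : Equiv.Perm (Fin m)) {w w' : ∀ i, UserMessages W R n i}
    (hw : w ∉ c.badSet) (hw' : w' ∉ c.badSet)
    (hy : c.output Finset.univ w = c.output Finset.univ w')
    (hv : ∀ i, ∀ j ∉ chainDecoded W σ i, w i j = w' i j) : w = w' := by
  have key : ∀ k : Fin m, w (σ k) = w' (σ k) := by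
    intro k
    -- The induction descends from the last position: the users after `k` are known, so their
    -- codewords cancel from the full sum and leave the output of the prefix state.
    induction k using WellFoundedGT.induction with
    | ind k ih =>
      have hout : c.output (prefixSet σ k) w = c.output (prefixSet σ k) w' := by
        funext t
        have ht := congrFun hy t
        simp only [Code.output] at ht ⊢
        rw [← Finset.sum_add_sum_compl (prefixSet σ k) (fun i => c.enc i (w i) t),
          ← Finset.sum_add_sum_compl (prefixSet σ k) (fun i => c.enc i (w' i) t)] at ht
        have hc : ∑ i ∈ (prefixSet σ k)ᶜ, c.enc i (w i) t
            = ∑ i ∈ (prefixSet σ k)ᶜ, c.enc i (w' i) t := by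
          refine Finset.sum_congr rfl fun i hi => ?_
          rw [Finset.mem_compl, mem_prefixSet, not_le] at hi
          have := ih _ hi
          rw [Equiv.apply_symm_apply] at this
          rw [this]
        rw [hc] at ht
        exact add_right_cancel ht
      funext j
      by_cases hj : j ∈ chainDecoded W σ (σ k)
      · have hj' : j ∈ W.decoded ⟨(σ k, prefixSet σ k), apply_mem_prefixSet σ k⟩ := by
          unfold chainDecoded at hj
          convert hj using 4
          simp
        have h1 : c.dec (prefixSet σ k) (c.output (prefixSet σ k) w) (σ k) j = w (σ k) j := by
          by_contra hne
          exact hw ⟨_, _, apply_mem_prefixSet σ k, j, hj', hne⟩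
        have h2 : c.dec (prefixSet σ k) (c.output (prefixSet σ k) w') (σ k) j = w' (σ k) j := by
          by_contra hne
          exact hw' ⟨_, _, apply_mem_prefixSet σ k, j, hj', hne⟩
        rw [← h1, ← h2, hout]
      · exact hv _ _ hj
  funext i
  have := key (σ.symm i)
  rwa [Equiv.apply_symm_apply] at this

lemma Code.ncard_badSet_le {m : ℕ} {W : MessageStructure m} {R : MessageRates W} {n : ℕ}
    (c : Code W R n) :
    (c.badSet.ncard : ℝ)
      ≤ (∑ A, c.errorProb A) * (Nat.card (∀ i, UserMessages W R n i) : ℝ) := by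
  have hne : (Nat.card (∀ i, UserMessages W R n i) : ℝ) ≠ 0 := by
    have : Nonempty (∀ i, UserMessages W R n i) :=
      ⟨fun i j => ⟨0, one_le_msgCard n (R i j)⟩⟩
    exact_mod_cast Nat.card_pos.ne'
  have hU : c.badSet = ⋃ A ∈ (Finset.univ : Finset (Finset (Fin m))),
      {w | ∃ (i : Fin m) (hi : i ∈ A), ∃ j ∈ W.decoded ⟨(i, A), hi⟩,
        c.dec A (c.output A w) i j ≠ w i j} := by
    ext w
    simp only [Code.badSet, Finset.mem_univ, iUnion_true, mem_iUnion, mem_ofPred_eq]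
  rw [Finset.sum_mul, hU]
  refine (Nat.cast_le.2 (Finset.set_ncard_biUnion_le _ _)).trans ?_
  rw [Nat.cast_sum]
  refine Finset.sum_le_sum fun A _ => ?_
  rw [Code.errorProb, div_mul_cancel₀ _ hne]
  exact le_rfl

/-- A counting form of Fano's inequality: error-free message tuples inject into pairs of an output
sequence and the messages not decoded along the chain. The number of the latter then cancels. -/
lemma Code.one_sub_mul_prod_msgCard_le {m : ℕ} {W : MessageStructure m} {R : MessageRates W}
    {n : ℕ} (c : Code W R n) (σ : Equiv.Perm (Fin m)) :
    (1 - ∑ A, c.errorProb A) * ∏ i, ∏ j ∈ chainDecoded W σ i, (msgCard n (R i j) : ℝ)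
      ≤ 2 ^ n := by
  classical
  let V := ∀ i : Fin m, ∀ j : {j : Fin (W.numMsg i) // j ∉ chainDecoded W σ i},
    Fin (msgCard n (R i j))
  have hV : (Nat.card V : ℝ) = ∏ i, ∏ j ∈ (chainDecoded W σ i)ᶜ, (msgCard n (R i j) : ℝ) := by
    rw [Nat.card_eq_fintype_card, Fintype.card_pi, Nat.cast_prod]
    refine Finset.prod_congr rfl fun i _ => ?_
    rw [Fintype.card_pi, Nat.cast_prod]
    simp only [Fintype.card_fin]
    exact (Finset.prod_subtype _ (fun j => Finset.mem_compl)
      (fun j => (msgCard n (R i j) : ℝ))).symm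
  have hVpos : (0 : ℝ) < Nat.card V := by
    rw [hV]
    refine Finset.prod_pos fun i _ => Finset.prod_pos fun j _ => ?_
    exact_mod_cast one_le_msgCard n (R i j)
  have hO : (Nat.card (∀ i, UserMessages W R n i) : ℝ)
      = (∏ i, ∏ j ∈ chainDecoded W σ i, (msgCard n (R i j) : ℝ)) * Nat.card V := by
    rw [hV, ← Finset.prod_mul_distrib, Nat.card_eq_fintype_card, Fintype.card_pi, Nat.cast_prod]
    refine Finset.prod_congr rfl fun i _ => ?_
    rw [Fintype.card_pi, Nat.cast_prod, Finset.prod_mul_prod_compl]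
    simp only [Fintype.card_fin]
  have hinj : c.badSetᶜ.ncard ≤ Nat.card ((Fin n → ZMod 2) × V) := by
    rw [← Nat.card_coe_set_eq]
    refine Nat.card_le_card_of_injective
      (fun w => (c.output Finset.univ w.1, fun i j => w.1 i j.1)) ?_
    rintro ⟨w, hw⟩ ⟨w', hw'⟩ h
    rw [Prod.mk.injEq] at h
    refine Subtype.ext (c.eq_of_notMem_badSet σ hw hw' h.1 fun i j hj => ?_)
    exact congrFun (congrFun h.2 i) ⟨j, hj⟩
  have hcard : (Nat.card ((Fin n → ZMod 2) × V) : ℝ) = 2 ^ n * Nat.card V := by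
    rw [Nat.card_prod, Nat.cast_mul]
    simp
  have hsplit : (c.badSet.ncard : ℝ) + c.badSetᶜ.ncard = Nat.card (∀ i, UserMessages W R n i) := by
    exact_mod_cast Set.ncard_add_ncard_compl c.badSet
  have h1 := c.ncard_badSet_le
  have h2 : (c.badSetᶜ.ncard : ℝ) ≤ 2 ^ n * Nat.card V := by
    rw [← hcard]
    exact_mod_cast hinj
  refine le_of_mul_le_mul_right ?_ hVpos
  rw [mul_assoc, ← hO]
  linarith

/-- The rate tuples satisfying the constraints of the converse. -/
def outerRegion (m : ℕ) : Set (RateTuple m) :=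
  {r | (∀ x, 0 ≤ r x) ∧
    (∀ (i : Fin m) (A B : Finset (Fin m)) (hi : i ∈ A) (hAB : A ⊆ B),
      r ⟨(i, B), hAB hi⟩ ≤ r ⟨(i, A), hi⟩) ∧
    ∀ σ : Equiv.Perm (Fin m), ∑ k, extRate r (σ k) (prefixSet σ k) ≤ 1}

lemma isClosed_outerRegion (m : ℕ) : IsClosed (outerRegion m) := by
  have h1 : IsClosed {r : RateTuple m | ∀ x, 0 ≤ r x} := by
    simp only [ofPred_forall]
    exact isClosed_iInter fun x => isClosed_le continuous_const (continuous_apply x)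
  have h2 : IsClosed {r : RateTuple m | ∀ (i : Fin m) (A B : Finset (Fin m)) (hi : i ∈ A)
      (hAB : A ⊆ B), r ⟨(i, B), hAB hi⟩ ≤ r ⟨(i, A), hi⟩} := by
    simp only [ofPred_forall]
    exact isClosed_iInter fun i => isClosed_iInter fun A => isClosed_iInter fun B =>
      isClosed_iInter fun hi => isClosed_iInter fun hAB =>
        isClosed_le (continuous_apply _) (continuous_apply _)
  have h3 : IsClosed {r : RateTuple m | ∀ σ : Equiv.Perm (Fin m),
      ∑ k, extRate r (σ k) (prefixSet σ k) ≤ 1} := by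
    simp only [ofPred_forall]
    refine isClosed_iInter fun σ => isClosed_le (continuous_finsetSum _ fun k _ => ?_)
      continuous_const
    simp only [extRate_of_mem _ (apply_mem_prefixSet σ k)]
    exact continuous_apply _
  exact h1.inter (h2.inter h3)

lemma two_rpow_le_msgCard (n : ℕ) (R : ℝ) : (2 : ℝ) ^ ((n : ℝ) * R) ≤ msgCard n R :=
  Nat.le_ceil _

lemma Achievable.chain_sum_le {m : ℕ} {W : MessageStructure m} {r : RateTuple m}
    (h : Achievable W r) (σ : Equiv.Perm (Fin m)) :
    ∑ k, extRate r (σ k) (prefixSet σ k) ≤ 1 := by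
  obtain ⟨R, hR, rfl, c, hc⟩ := h
  set s := ∑ i, ∑ j ∈ chainDecoded W σ i, R i j with hs
  have hsum : ∑ k, extRate (rateTuple W R) (σ k) (prefixSet σ k) = s := by
    rw [hs, ← Equiv.sum_comp σ (fun i => ∑ j ∈ chainDecoded W σ i, R i j)]
    refine Finset.sum_congr rfl fun k _ => ?_
    rw [extRate_of_mem _ (apply_mem_prefixSet σ k), rateTuple]
    unfold chainDecoded
    congr 4
    simp
  rw [hsum]
  have hε : Tendsto (fun n => ∑ A, (c n).errorProb A) atTop (𝓝 0) := by
    simpa using tendsto_finsetSum Finset.univ fun A _ => hc A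
  have hpow : ∀ n : ℕ, (2 : ℝ) ^ ((n : ℝ) * s)
      ≤ ∏ i, ∏ j ∈ chainDecoded W σ i, (msgCard n (R i j) : ℝ) := by
    intro n
    rw [hs, Finset.mul_sum, Real.rpow_sum_of_pos two_pos]
    refine Finset.prod_le_prod (fun _ _ => by positivity) fun i _ => ?_
    rw [Finset.mul_sum, Real.rpow_sum_of_pos two_pos]
    exact Finset.prod_le_prod (fun _ _ => by positivity) fun j _ => two_rpow_le_msgCard n _
  -- If the sum exceeded 1, then for large `n` the decoded messages would take more than `2 · 2 ^ n`
  -- values while the total error is below `1 / 2`, against the counting bound.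
  by_contra! hlt
  have hev : ∀ᶠ n in atTop, ∑ A, (c n).errorProb A < 1 / 2 := hε.eventually_lt_const (by norm_num)
  have hgrow : Tendsto (fun n : ℕ => ((2 : ℝ) ^ (s - 1)) ^ n) atTop atTop :=
    tendsto_pow_atTop_atTop_of_one_lt (Real.one_lt_rpow one_lt_two (by linarith))
  obtain ⟨n, hn1, hn2⟩ := (hev.and (hgrow.eventually_gt_atTop 2)).exists
  have h1 := (c n).one_sub_mul_prod_msgCard_le σ
  have h2 : ((2 : ℝ) ^ (s - 1)) ^ n * 2 ^ n = (2 : ℝ) ^ ((n : ℝ) * s) := by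
    rw [← Real.rpow_natCast, ← Real.rpow_natCast, ← Real.rpow_mul two_pos.le,
      ← Real.rpow_add two_pos]
    congr 1
    ring
  have h3 := hpow n
  have h4 : (0 : ℝ) < 2 ^ n := by positivity
  have h5 : 2 * (2 : ℝ) ^ n < (2 : ℝ) ^ ((n : ℝ) * s) := by
    rw [← h2]
    exact mul_lt_mul_of_pos_right hn2 h4
  nlinarith

lemma Achievable.mem_outerRegion {m : ℕ} {W : MessageStructure m} {r : RateTuple m}
    (h : Achievable W r) : r ∈ outerRegion m := by
  refine ⟨?_, ?_, h.chain_sum_le⟩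
  · obtain ⟨R, hR, rfl, -⟩ := h
    exact fun x => Finset.sum_nonneg fun j _ => hR _ _
  · obtain ⟨R, hR, rfl, -⟩ := h
    intro i A B hi hAB
    exact Finset.sum_le_sum_of_subset_of_nonneg (W.decoded_subset i A B hi hAB)
      fun j _ _ => hR _ _

lemma capacityRegion_subset_outerRegion (m : ℕ) : capacityRegion m ⊆ outerRegion m :=
  closure_minimal (iUnion_subset fun _ =>
    closure_minimal (fun _ h => Achievable.mem_outerRegion h) (isClosed_outerRegion m))
    (isClosed_outerRegion m)

/-! ### Symmetrization -/

lemma expectedSumRate_eq_extRate {m : ℕ} (p : ℝ) (r : RateTuple m) :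
    expectedSumRate p r
      = ∑ A : Finset (Fin m), p ^ A.card * (1 - p) ^ (m - A.card) * ∑ i ∈ A, extRate r i A := by
  refine Finset.sum_congr rfl fun A _ => ?_
  rw [← Finset.sum_coe_sort A]
  congr 1
  exact Finset.sum_congr rfl fun i _ => (extRate_of_mem r i.2).symm

/-- Every pair `i ∈ A` arises from a position `k` and an ordering of the users. -/
lemma exists_perm_prefixSet_eq {m : ℕ} {i : Fin m} {A : Finset (Fin m)} (hi : i ∈ A) (k : Fin m)
    (hA : A.card = k + 1) : ∃ τ : Equiv.Perm (Fin m), τ k = i ∧ prefixSet τ k = A := by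
  classical
  have hcard : Fintype.card {j // j ∈ Finset.Iio k} = Fintype.card {j // j ∈ A.erase i} := by
    rw [Fintype.card_coe, Fintype.card_coe, Finset.card_erase_of_mem hi, hA, Fin.card_Iio,
      Nat.add_sub_cancel]
  let e := Fintype.equivOfCardEq hcard
  let σ : Equiv.Perm (Fin m) := e.extendSubtype
  have hσ : ∀ j, j ∈ Finset.Iio k → σ j ∈ A.erase i := fun j hj => e.extendSubtype_mem j hj
  have hσk : σ k ∉ A.erase i := e.extendSubtype_not_mem k (by simp)
  -- The swap sends position `k` to `i` and leaves the earlier positions alone, since their images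
  -- lie in `A.erase i`, which contains neither `σ k` nor `i`.
  let τ : Equiv.Perm (Fin m) := σ.trans (Equiv.swap (σ k) i)
  have hτk : τ k = i := by simp [τ]
  refine ⟨τ, hτk, ?_⟩
  refine Finset.eq_of_subset_of_card_le (fun x hx => ?_) ?_
  · rw [prefixSet, Finset.mem_map] at hx
    obtain ⟨j, hj, rfl⟩ := hx
    rcases (Finset.mem_Iic.1 hj).eq_or_lt with rfl | hlt
    · exact (congrArg (· ∈ A) hτk).mpr hi
    · have h1 := hσ j (Finset.mem_Iio.2 hlt)
      have h2 : τ j = σ j := by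
        refine Equiv.swap_apply_of_ne_of_ne (fun h => hσk (h ▸ h1)) (Finset.ne_of_mem_erase h1)
      change τ j ∈ A
      rw [h2]
      exact Finset.mem_of_mem_erase h1
  · rw [prefixSet, Finset.card_map, Fin.card_Iic, hA]

/-- The sum over all orderings of the users of the rate of the user in position `k`, when the
users up to that position are active. -/
noncomputable def positionSum {m : ℕ} (r : RateTuple m) (k : Fin m) : ℝ :=
  ∑ σ : Equiv.Perm (Fin m), extRate r (σ k) (prefixSet σ k)

/-- Relabelling by a `τ` that carries position `k` and its prefix to `(i, A)` only permutes the
summands, so the symmetrized rate depends on `A.card` alone. -/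
lemma sum_perm_extRate_map {m : ℕ} (r : RateTuple m) {i : Fin m} {A : Finset (Fin m)}
    (hi : i ∈ A) (k : Fin m) (hA : A.card = k + 1) :
    ∑ σ : Equiv.Perm (Fin m), extRate r (σ i) (A.map σ.toEmbedding) = positionSum r k := by
  obtain ⟨τ, rfl, rfl⟩ := exists_perm_prefixSet_eq hi k hA
  refine (Finset.sum_congr rfl fun σ _ => ?_).trans
    (Equiv.sum_comp (Equiv.mulRight τ) fun σ => extRate r (σ k) (prefixSet σ k))
  simp only [prefixSet, Finset.map_map]
  rfl

/-- Removing the user in position `k` from the prefix up to `l` can only raise the rate of the user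
in position `l`; after symmetrization the smaller state counts as position `k`. -/
lemma positionSum_succ_le {m : ℕ} {r : RateTuple m} (hr : r ∈ outerRegion m) {k l : Fin m}
    (hkl : (l : ℕ) = k + 1) : positionSum r l ≤ positionSum r k := by
  have hkl' : k < l := by rw [Fin.lt_def]; omega
  have hc : ((Finset.Iic l).erase k).card = k + 1 := by
    rw [Finset.card_erase_of_mem (Finset.mem_Iic.2 hkl'.le), Fin.card_Iic]
    omega
  have hl : l ∈ (Finset.Iic l).erase k := by simp [hkl'.ne']
  rw [← sum_perm_extRate_map r hl k hc]
  refine Finset.sum_le_sum fun σ _ => ?_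
  have hmem : σ l ∈ ((Finset.Iic l).erase k).map σ.toEmbedding := Finset.mem_map_of_mem _ hl
  rw [extRate_of_mem r hmem, extRate_of_mem r (apply_mem_prefixSet σ l)]
  exact hr.2.1 (σ l) _ _ hmem (Finset.map_subset_map.2 (Finset.erase_subset _ _))

lemma positionSum_nonneg {m : ℕ} {r : RateTuple m} (hr : r ∈ outerRegion m) (k : Fin m) :
    0 ≤ positionSum r k :=
  Finset.sum_nonneg fun σ _ => by
    rw [extRate_of_mem r (apply_mem_prefixSet σ k)]
    exact hr.1 _

lemma sum_positionSum_le {m : ℕ} {r : RateTuple m} (hr : r ∈ outerRegion m) :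
    ∑ k, positionSum r k ≤ (Fintype.card (Equiv.Perm (Fin m)) : ℝ) := by
  unfold positionSum
  rw [Finset.sum_comm]
  refine (Finset.sum_le_sum fun σ _ => hr.2.2 σ).trans ?_
  simp

lemma sum_powerset_card_mul (m : ℕ) (p : ℝ) (g : ℕ → ℝ) :
    ∑ A : Finset (Fin m), p ^ A.card * (1 - p) ^ (m - A.card) * (A.card * g A.card)
      = m * p * ∑ k ∈ Finset.range m, binomProb (m - 1) k p * g (k + 1) := by
  have h := Finset.sum_powerset_apply_card
    (fun j => p ^ j * (1 - p) ^ (m - j) * (j * g j)) (x := (Finset.univ : Finset (Fin m)))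
  rw [Finset.powerset_univ, Finset.card_univ, Fintype.card_fin] at h
  rw [h, Finset.sum_range_succ', Finset.mul_sum]
  simp only [Nat.cast_zero, zero_mul, mul_zero, smul_zero, add_zero, nsmul_eq_mul]
  refine Finset.sum_congr rfl fun k hk => ?_
  obtain ⟨n, rfl⟩ := Nat.exists_eq_add_of_lt (Finset.mem_range.1 hk)
  have hc : ((k + n + 1 : ℕ) : ℝ) * (k + n).choose k = (k + n + 1).choose (k + 1) * ((k + 1 : ℕ) : ℝ) := by
    exact_mod_cast Nat.add_one_mul_choose_eq (k + n) k
  rw [binomProb, Nat.add_sub_cancel, show k + n + 1 - (k + 1) = k + n - k by omega, pow_succ]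
  linear_combination -p ^ k * p * (1 - p) ^ (k + n - k) * g (k + 1) * hc

lemma card_perm_mul_expectedSumRate {m : ℕ} (p : ℝ) (r : RateTuple m) (ρ : ℕ → ℝ)
    (hρ : ∀ k : Fin m, positionSum r k = ρ k) :
    (Fintype.card (Equiv.Perm (Fin m)) : ℝ) * expectedSumRate p r
      = m * p * ∑ k ∈ Finset.range m, binomProb (m - 1) k p * ρ k := by
  have h1 : ∀ σ : Equiv.Perm (Fin m), expectedSumRate p r
      = ∑ A : Finset (Fin m), p ^ A.card * (1 - p) ^ (m - A.card)
        * ∑ i ∈ A, extRate r (σ i) (A.map σ.toEmbedding) := fun σ => by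
    rw [expectedSumRate_eq_extRate, ← Equiv.sum_comp σ.finsetCongr]
    refine Finset.sum_congr rfl fun A _ => ?_
    simp only [Equiv.finsetCongr_apply, Finset.card_map, Finset.sum_map, Equiv.coe_toEmbedding]
  have h2 : (Fintype.card (Equiv.Perm (Fin m)) : ℝ) * expectedSumRate p r
      = ∑ σ : Equiv.Perm (Fin m), ∑ A : Finset (Fin m), p ^ A.card * (1 - p) ^ (m - A.card)
        * ∑ i ∈ A, extRate r (σ i) (A.map σ.toEmbedding) := by
    rw [← Finset.sum_congr rfl fun σ _ => h1 σ, Finset.sum_const, nsmul_eq_mul, Finset.card_univ]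
  rw [h2, Finset.sum_comm]
  -- Positions start at 0, so a state of size `k` corresponds to position `k - 1`.
  have h3 := sum_powerset_card_mul m p (fun k => ρ (k - 1))
  simp only [Nat.add_sub_cancel] at h3
  rw [← h3]
  refine Finset.sum_congr rfl fun A _ => ?_
  rw [← Finset.mul_sum, Finset.sum_comm, ← nsmul_eq_mul, ← Finset.sum_const]
  congr 1
  refine Finset.sum_congr rfl fun i hi => ?_
  have hpos : 0 < A.card := Finset.card_pos.2 ⟨i, hi⟩
  have hle : A.card ≤ m := by simpa using Finset.card_le_univ A
  rw [sum_perm_extRate_map r hi ⟨A.card - 1, by omega⟩ (by simp; omega), hρ]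

/-! ### The linear program -/

/-- A bound by summation by parts: a decreasing sequence is a conic combination of the indicators
of initial segments. -/
lemma sum_mul_le_of_antitone {m : ℕ} {b ρ : ℕ → ℝ} {M : ℝ}
    (hM : ∀ k, 1 ≤ k → k ≤ m → ∑ i ∈ Finset.range k, b i ≤ k * M) (hρ0 : ∀ k < m, 0 ≤ ρ k)
    (hρ : ∀ k, k + 1 < m → ρ (k + 1) ≤ ρ k) :
    ∑ k ∈ Finset.range m, b k * ρ k ≤ M * ∑ k ∈ Finset.range m, ρ k := by
  -- The partial sums of `b k - M` are non-positive, so replacing `ρ j` by the smaller `ρ (j + 1)`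
  -- as their factor only increases the bound.
  have key : ∀ j, j < m → ∑ k ∈ Finset.range (j + 1), (b k - M) * ρ k
      ≤ (∑ k ∈ Finset.range (j + 1), (b k - M)) * ρ j := by
    intro j
    induction j with
    | zero => intro _; simp
    | succ j ih =>
      intro hj
      rw [Finset.sum_range_succ, Finset.sum_range_succ _ (j + 1), add_mul]
      have h1 := hM (j + 1) (by omega) (by omega)
      have h2 : ∑ k ∈ Finset.range (j + 1), (b k - M) ≤ 0 := by
        rw [Finset.sum_sub_distrib, Finset.sum_const, Finset.card_range, nsmul_eq_mul]
        linarith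
      have h3 := mul_le_mul_of_nonpos_left (hρ j hj) h2
      have := ih (by omega)
      linarith
  rcases m.eq_zero_or_pos with rfl | hm
  · simp
  · have h := key (m - 1) (by omega)
    rw [Nat.sub_add_cancel hm] at h
    have h1 : ∑ k ∈ Finset.range m, (b k - M) ≤ 0 := by
      rw [Finset.sum_sub_distrib, Finset.sum_const, Finset.card_range, nsmul_eq_mul]
      linarith [hM m hm le_rfl]
    have h2 := mul_nonpos_of_nonpos_of_nonneg h1 (hρ0 (m - 1) (by omega))
    simp only [sub_mul, Finset.sum_sub_distrib, ← Finset.mul_sum] at h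
    simp only [Finset.sum_sub_distrib] at h2
    linarith

lemma expectedSumRate_le {m : ℕ} {p M : ℝ} (hp : 0 ≤ p) (hM0 : 0 ≤ M)
    (hM : ∀ k, 1 ≤ k → k ≤ m → binomSum (m - 1) k p ≤ k * M) {r : RateTuple m}
    (hr : r ∈ outerRegion m) : expectedSumRate p r ≤ m * p * M := by
  set N : ℝ := (Fintype.card (Equiv.Perm (Fin m)) : ℝ) with hN
  have hNpos : 0 < N := by rw [hN]; exact_mod_cast Fintype.card_pos
  let ρ : ℕ → ℝ := fun k => if h : k < m then positionSum r ⟨k, h⟩ else 0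
  have hρ : ∀ k : Fin m, positionSum r k = ρ k := fun k => by simp [ρ]
  have h1 := card_perm_mul_expectedSumRate p r ρ hρ
  have h2 : ∑ k ∈ Finset.range m, binomProb (m - 1) k p * ρ k
      ≤ M * ∑ k ∈ Finset.range m, ρ k := by
    refine sum_mul_le_of_antitone hM (fun k hk => ?_) fun k hk => ?_
    · rw [← hρ ⟨k, hk⟩]
      exact positionSum_nonneg hr _
    · rw [← hρ ⟨k, by omega⟩, ← hρ ⟨k + 1, hk⟩]
      exact positionSum_succ_le hr rfl
  have h3 : ∑ k ∈ Finset.range m, ρ k ≤ N := by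
    rw [Finset.sum_range, ← Finset.sum_congr rfl fun k _ => hρ k]
    exact sum_positionSum_le hr
  refine le_of_mul_le_mul_left ?_ hNpos
  rw [h1]
  have hmp : 0 ≤ m * p := by positivity
  calc m * p * ∑ k ∈ Finset.range m, binomProb (m - 1) k p * ρ k
      ≤ m * p * (M * N) := by gcongr; exact h2.trans (by gcongr)
    _ = N * (m * p * M) := by ring

lemma expectedSumRate_singleMessage {m k : ℕ} (hkm : k ≤ m) (p R : ℝ) :
    expectedSumRate p (rateTuple (singleMessage m k) (singleRate m k R))
      = m * p * R * binomSum (m - 1) k p := by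
  have h1 : expectedSumRate p (rateTuple (singleMessage m k) (singleRate m k R))
      = ∑ A : Finset (Fin m), p ^ A.card * (1 - p) ^ (m - A.card)
        * (A.card * if A.card ≤ k then R else 0) := by
    refine Finset.sum_congr rfl fun A _ => ?_
    have h : ∀ i : {i : Fin m // i ∈ A},
        rateTuple (singleMessage m k) (singleRate m k R) ⟨(i.1, A), i.2⟩
          = if A.card ≤ k then R else 0 := fun i => by
      split_ifs with hA <;> simp [rateTuple, singleMessage, singleRate, hA]
    rw [Finset.sum_congr rfl fun i _ => h i, Finset.sum_const, nsmul_eq_mul, Finset.card_univ,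
      Fintype.card_coe]
  have h2 : ∑ i ∈ Finset.range m, binomProb (m - 1) i p * (if i + 1 ≤ k then R else 0)
      = R * binomSum (m - 1) k p := by
    rw [← Finset.sum_subset (Finset.range_subset_range.2 hkm), binomSum, Finset.mul_sum]
    · refine Finset.sum_congr rfl fun i hi => ?_
      rw [if_pos (Nat.succ_le_of_lt (Finset.mem_range.1 hi)), mul_comm]
    · intro i _ hi
      rw [if_neg (fun h : i + 1 ≤ k => hi (Finset.mem_range.2 h)), mul_zero]
  refine h1.trans ((sum_powerset_card_mul m p fun j => if j ≤ k then R else 0).trans ?_)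
  rw [h2, mul_assoc (m * p)]

/-! ### Achievability -/

/-- Reed–Solomon multiple-access code: any at most `k` of the `m` users can be told apart from the
sum of their codewords. -/
lemma exists_sum_separating_enc {m k L n c : ℕ} (hL : L ≠ 0) (hm : m ≤ 2 ^ L) (hn : k * L ≤ n)
    (hc : c ≤ 2 ^ L) :
    ∃ enc : Fin m → Fin c → (Fin n → ZMod 2), ∀ A : Finset (Fin m), A.card ≤ k →
      ∀ w w' : Fin m → Fin c, ∑ i ∈ A, enc i (w i) = ∑ i ∈ A, enc i (w' i) →
        ∀ i ∈ A, w i = w' i := by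
  classical
  have := Fintype.ofFinite (GaloisField 2 L)
  have hcard : Fintype.card (GaloisField 2 L) = 2 ^ L := by
    rw [← Nat.card_eq_fintype_card, GaloisField.card 2 L hL]
  obtain ⟨α⟩ : Nonempty (Fin m ↪ GaloisField 2 L) :=
    Function.Embedding.nonempty_of_card_le (by rwa [Fintype.card_fin, hcard])
  obtain ⟨e⟩ : Nonempty (Fin c ↪ GaloisField 2 L) :=
    Function.Embedding.nonempty_of_card_le (by rwa [Fintype.card_fin, hcard])
  obtain ⟨ι⟩ : Nonempty (Fin k × Fin L ↪ Fin n) :=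
    Function.Embedding.nonempty_of_card_le (by simpa using hn)
  let lin : GaloisField 2 L ≃ₗ[ZMod 2] (Fin L → ZMod 2) :=
    LinearEquiv.ofFinrankEq _ _ (by rw [GaloisField.finrank 2 hL, Module.finrank_fin_fun])
  -- User `i` sends the `k` field elements `e w * α i ^ a`, `a < k`, as blocks of `L` bits; the
  -- unused time slots carry 0.
  refine ⟨fun i w => Function.extend ι (fun ab => lin (e w * α i ^ (ab.1 : ℕ)) ab.2) 0, ?_⟩
  intro A hA w w' h
  have hsum : ∀ a : Fin k, ∑ i ∈ A, (e (w i) - e (w' i)) * α i ^ (a : ℕ) = 0 := by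
    intro a
    apply lin.injective
    funext b
    have hab := congrFun h (ι (a, b))
    simp only [Finset.sum_apply, ι.injective.extend_apply] at hab
    simp only [sub_mul, Finset.sum_sub_distrib, map_sub, map_sum, map_zero, Pi.sub_apply,
      Finset.sum_apply, Pi.zero_apply, hab, sub_self]
  let f := A.orderIsoOfFin rfl
  -- Vandermonde with distinct nodes: as `A.card ≤ k`, the first `A.card` power sums are available
  -- and force all differences to vanish.
  have hzero := Matrix.eq_zero_of_forall_pow_sum_mul_pow_eq_zero
    (f := fun j : Fin A.card => α (f j)) (v := fun j => e (w (f j)) - e (w' (f j)))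
    (fun j j' hj => f.injective (Subtype.ext (α.injective hj))) (fun a => by
      rw [← hsum ⟨a, a.2.trans_le hA⟩, ← Finset.sum_coe_sort A]
      exact Equiv.sum_comp f.toEquiv
        (fun i : A => (e (w i) - e (w' i)) * α i ^ (a : ℕ)))
  intro i hi
  have := congrFun hzero (f.symm ⟨i, hi⟩)
  simp only [OrderIso.apply_symm_apply, Pi.zero_apply, sub_eq_zero] at this
  exact e.injective this

instance {m : ℕ} (W : MessageStructure m) (R : MessageRates W) (n : ℕ) (i : Fin m) :
    Nonempty (UserMessages W R n i) :=
  ⟨fun j => ⟨0, one_le_msgCard n (R i j)⟩⟩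

/-- The decoder returns any message tuple consistent with the output, and an arbitrary one if there
is none. -/
lemma exists_code_of_enc {m : ℕ} {W : MessageStructure m} {R : MessageRates W} {n : ℕ}
    (enc : ∀ i : Fin m, UserMessages W R n i → (Fin n → ZMod 2)) :
    ∃ c : Code W R n, c.enc = enc ∧
      ∀ A w, c.output A (c.dec A (c.output A w)) = c.output A w := by
  have hex : ∀ (A : Finset (Fin m)) (y : Fin n → ZMod 2), ∃ w : ∀ i, UserMessages W R n i,
      (∃ w' : ∀ i, UserMessages W R n i, (fun t => ∑ i ∈ A, enc i (w' i) t) = y) →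
        (fun t => ∑ i ∈ A, enc i (w i) t) = y := fun A y => by
    by_cases h : ∃ w' : ∀ i, UserMessages W R n i, (fun t => ∑ i ∈ A, enc i (w' i) t) = y
    · obtain ⟨w, hw⟩ := h
      exact ⟨w, fun _ => hw⟩
    · exact ⟨Classical.arbitrary _, fun h' => absurd h' h⟩
  choose dec hdec using hex
  exact ⟨⟨enc, dec⟩, rfl, fun A w => hdec A _ ⟨w, rfl⟩⟩

lemma exists_code_singleMessage {m k L n : ℕ} {R : ℝ} (hL : L ≠ 0) (hm : m ≤ 2 ^ L)
    (hn : k * L ≤ n) (hR : n * R ≤ L) :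
    ∃ c : Code (singleMessage m k) (singleRate m k R) n, ∀ A, c.errorProb A = 0 := by
  have hc : msgCard n R ≤ 2 ^ L := by
    refine Nat.ceil_le.2 ?_
    push_cast
    rw [← Real.rpow_natCast]
    exact Real.rpow_le_rpow_of_exponent_le one_le_two hR
  obtain ⟨enc, henc⟩ := exists_sum_separating_enc hL hm hn hc
  obtain ⟨c, hce, hcd⟩ := exists_code_of_enc (W := singleMessage m k) (R := singleRate m k R)
    (fun i (w : ∀ _ : Fin 1, Fin (msgCard n R)) => enc i (w 0))
  refine ⟨c, fun A => ?_⟩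
  rw [Code.errorProb, div_eq_zero_iff]
  left
  rw [Nat.cast_eq_zero, Nat.card_eq_zero]
  left
  refine ⟨fun ⟨w, i, hi, j, hj, hne⟩ => hne ?_⟩
  have hA : A.card ≤ k := by
    by_contra hA
    simp only [singleMessage, if_neg hA] at hj
    exact Finset.notMem_empty _ hj
  have hout := hcd A w
  have hw := henc A hA (fun i => c.dec A (c.output A w) i (0 : Fin 1)) (fun i => w i (0 : Fin 1)) (by
    funext t
    simp only [Finset.sum_apply]
    have := congrFun hout t
    simp only [Code.output, hce] at this
    exact this) i hi
  have hj0 : j = (0 : Fin 1) := Subsingleton.elim (α := Fin 1) _ _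
  rw [hj0]
  exact hw

lemma achievable_singleMessage {m k : ℕ} (hk : 0 < k) {R : ℝ} (hR0 : 0 ≤ R)
    (hR : R < 1 / (k : ℝ)) :
    Achievable (singleMessage m k) (rateTuple (singleMessage m k) (singleRate m k R)) := by
  classical
  have hk' : (0 : ℝ) < k := by exact_mod_cast hk
  refine ⟨singleRate m k R, fun _ _ => hR0, rfl, ?_⟩
  have hev : ∀ᶠ n : ℕ in atTop, ∃ c : Code (singleMessage m k) (singleRate m k R) n,
      ∀ A, c.errorProb A = 0 := by
    have h1 : Tendsto (fun n : ℕ => n / k) atTop atTop := Nat.tendsto_div_const_atTop hk.ne'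
    have h2 : ∀ᶠ n : ℕ in atTop, 1 / (1 / (k : ℝ) - R) ≤ (n : ℝ) :=
      tendsto_natCast_atTop_atTop.eventually_ge_atTop _
    filter_upwards [h1.eventually_ge_atTop (m + 1), h2] with n hn1 hn2
    -- The slack `1 / k - R` absorbs the rounding in `⌊n / k⌋` once `n (1 / k - R) ≥ 1`. This is why
    -- rate `1 / k` itself is reached only in the closure.
    refine exists_code_singleMessage (L := n / k) (by omega) ?_ (Nat.mul_div_le n k) ?_
    · exact (by omega : m ≤ n / k).trans Nat.lt_two_pow_self.le
    · rw [div_le_iff₀ (sub_pos.2 hR), mul_sub] at hn2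
      have h3 : (n : ℝ) / k < (n / k : ℕ) + 1 := by
        rw [div_lt_iff₀ hk']
        have := Nat.lt_mul_div_succ n hk
        rw [mul_comm] at this
        exact_mod_cast this
      rw [mul_one_div] at hn2
      linarith
  have hex : ∀ n : ℕ, ∃ c : Code (singleMessage m k) (singleRate m k R) n,
      (∃ c : Code (singleMessage m k) (singleRate m k R) n, ∀ A, c.errorProb A = 0) →
        ∀ A, c.errorProb A = 0 := fun n => by
    by_cases h : ∃ c : Code (singleMessage m k) (singleRate m k R) n, ∀ A, c.errorProb A = 0
    · obtain ⟨c, hc⟩ := h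
      exact ⟨c, fun _ => hc⟩
    · obtain ⟨c, -⟩ := exists_code_of_enc (W := singleMessage m k) (R := singleRate m k R) (n := n)
        fun _ _ => 0
      exact ⟨c, fun h' => absurd h' h⟩
  choose c hc using hex
  refine ⟨c, fun A => ?_⟩
  refine tendsto_const_nhds.congr' ?_
  filter_upwards [hev] with n hn
  exact (hc n hn A).symm

lemma rateTuple_singleMessage_mem_capacityRegionOf (m : ℕ) {k : ℕ} (hk : 0 < k) :
    rateTuple (singleMessage m k) (singleRate m k (1 / (k : ℝ)))
      ∈ capacityRegionOf (singleMessage m k) := by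
  have hk' : (0 : ℝ) < k := by exact_mod_cast hk
  have hlim : Tendsto (fun R : ℝ => rateTuple (singleMessage m k) (singleRate m k R))
      (𝓝[<] (1 / (k : ℝ))) (𝓝 (rateTuple (singleMessage m k) (singleRate m k (1 / (k : ℝ))))) := by
    refine tendsto_nhdsWithin_of_tendsto_nhds (Continuous.tendsto ?_ _)
    unfold rateTuple singleRate
    fun_prop
  refine mem_closure_of_tendsto hlim ?_
  filter_upwards [Ioo_mem_nhdsLT (by positivity : (0 : ℝ) < 1 / k)] with R hR
  exact achievable_singleMessage hk hR.1.le hR.2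

/-! ### The throughput -/

lemma rateTuple_singleMessage_mem_capacityRegion (m : ℕ) {k : ℕ} (hk : 0 < k) :
    rateTuple (singleMessage m k) (singleRate m k (1 / (k : ℝ))) ∈ capacityRegion m :=
  subset_closure (mem_iUnion.2 ⟨_, rateTuple_singleMessage_mem_capacityRegionOf m hk⟩)

/-- If `F_{m-1,k-1}(p) / k` is maximal among all `k`, then the throughput is attained by single
messages of rate `1 / k`. -/
lemma isGreatest_of_forall_binomSum_le {m k : ℕ} (hk : 0 < k) (hkm : k ≤ m) {p : ℝ}
    (hp : p ∈ Icc (0 : ℝ) 1)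
    (h : ∀ j, 1 ≤ j → j ≤ m → binomSum (m - 1) j p / j ≤ binomSum (m - 1) k p / k) :
    IsGreatest (expectedSumRate p '' capacityRegion m) (m * p / k * binomSum (m - 1) k p) := by
  constructor
  · refine ⟨_, rateTuple_singleMessage_mem_capacityRegion m hk, ?_⟩
    rw [expectedSumRate_singleMessage hkm]
    ring
  · rintro _ ⟨r, hr, rfl⟩
    have hM0 : 0 ≤ binomSum (m - 1) k p / k :=
      div_nonneg (Finset.sum_nonneg fun i _ => binomProb_nonneg _ i hp) (Nat.cast_nonneg k)
    refine (expectedSumRate_le hp.1 hM0 (fun j hj hjm => ?_)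
      (capacityRegion_subset_outerRegion m hr)).trans_eq (by ring)
    have hj' : (0 : ℝ) < j := by exact_mod_cast hj
    rw [← div_le_iff₀' hj']
    exact h j hj hjm

lemma throughput_eq_of_forall_binomSum_le {m k : ℕ} (hk : 0 < k) (hkm : k ≤ m) {p : ℝ}
    (hp : p ∈ Icc (0 : ℝ) 1)
    (h : ∀ j, 1 ≤ j → j ≤ m → binomSum (m - 1) j p / j ≤ binomSum (m - 1) k p / k) :
    throughput m p = m * p / k * binomSum (m - 1) k p :=
  (isGreatest_of_forall_binomSum_le hk hkm hp h).csSup_eq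

lemma exists_forall_binomSum_le {m : ℕ} (hm : 0 < m) (p : ℝ) :
    ∃ k, 0 < k ∧ k ≤ m ∧
      ∀ j, 1 ≤ j → j ≤ m → binomSum (m - 1) j p / j ≤ binomSum (m - 1) k p / k := by
  obtain ⟨k, hk, h⟩ := Finset.exists_max_image (Finset.Icc 1 m)
    (fun j => binomSum (m - 1) j p / (j : ℝ)) ⟨1, Finset.mem_Icc.2 ⟨le_rfl, hm⟩⟩
  rw [Finset.mem_Icc] at hk
  exact ⟨k, hk.1, hk.2, fun j h1 h2 => h j (Finset.mem_Icc.2 ⟨h1, h2⟩)⟩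

lemma isGreatest_throughput {m : ℕ} (hm : 0 < m) {p : ℝ} (hp : p ∈ Icc (0 : ℝ) 1) :
    IsGreatest (expectedSumRate p '' capacityRegion m) (throughput m p) := by
  obtain ⟨k, hk, hkm, h⟩ := exists_forall_binomSum_le hm p
  rw [throughput_eq_of_forall_binomSum_le hk hkm hp h]
  exact isGreatest_of_forall_binomSum_le hk hkm hp h

/-- As `m p` times a maximum of finitely many polynomials, the throughput is continuous without any
matching at the thresholds. -/
lemma continuousOn_throughput {m : ℕ} (hm : 0 < m) : ContinuousOn (throughput m) (Icc 0 1) := by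
  have hne : (Finset.Icc 1 m).Nonempty := ⟨1, Finset.mem_Icc.2 ⟨le_rfl, hm⟩⟩
  have hc : Continuous fun p : ℝ =>
      m * p * (Finset.Icc 1 m).sup' hne fun j => binomSum (m - 1) j p / (j : ℝ) := by
    refine (by fun_prop : Continuous fun p : ℝ => m * p).mul ?_
    exact Continuous.finset_sup'_apply hne fun j _ => by fun_prop
  refine hc.continuousOn.congr fun p hp => ?_
  obtain ⟨k, hk, hkm, h⟩ := exists_forall_binomSum_le hm p
  rw [throughput_eq_of_forall_binomSum_le hk hkm hp h]
  have hsup : ((Finset.Icc 1 m).sup' hne fun j => binomSum (m - 1) j p / (j : ℝ))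
      = binomSum (m - 1) k p / k := by
    refine le_antisymm (Finset.sup'_le _ _ fun j hj => ?_)
      (Finset.le_sup' (fun j : ℕ => binomSum (m - 1) j p / (j : ℝ))
        (Finset.mem_Icc.2 ⟨hk, hkm⟩))
    rw [Finset.mem_Icc] at hj
    exact h j hj.1 hj.2
  simp only [hsup]
  ring

lemma binomSum_div_succ_sub (n : ℕ) {k : ℕ} (hk : 0 < k) (p : ℝ) :
    binomSum n (k + 1) p / ((k + 1 : ℕ) : ℝ) - binomSum n k p / k
      = binomGap n k p / (k * (k + 1)) := by
  have hk' : (0 : ℝ) < k := by exact_mod_cast hk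
  rw [binomSum_succ, binomGap]
  push_cast
  field_simp
  ring

/-- A sequence that increases up to `k` and decreases from `k` on is maximal at `k`. -/
lemma le_of_unimodal {m k : ℕ} {a : ℕ → ℝ} (h1 : ∀ j, 0 < j → j < k → a j ≤ a (j + 1))
    (h2 : ∀ j, k ≤ j → j < m → a (j + 1) ≤ a j) (j : ℕ) (hj : 1 ≤ j) (hjm : j ≤ m) :
    a j ≤ a k := by
  rcases le_total j k with hjk | hkj
  · have : ∀ i, j ≤ i → i ≤ k → a j ≤ a i := fun i hi => by
      induction i, hi using Nat.le_induction with
      | base => exact fun _ => le_rfl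
      | succ l hl ih => exact fun hlk => (ih (by omega)).trans (h1 l (by omega) (by omega))
    exact this k hjk le_rfl
  · induction j, hkj using Nat.le_induction with
    | base => exact le_rfl
    | succ l hl ih =>
      rcases l.eq_zero_or_pos with rfl | hl0
      · exact (h2 0 hl (by omega)).trans_eq (congrArg a (by omega))
      · exact (h2 l hl (by omega)).trans (ih hl0 (by omega))

/-! ### Sequences of thresholds -/

/-- The thresholds `p_0 = 0, p_1, …, p_{m-1}, p_m = 1`. -/
structure IsThresholdSeq (m : ℕ) (q : ℕ → ℝ) : Prop where
  zero : q 0 = 0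
  last : q m = 1
  isThreshold : ∀ k : ℕ, 0 < k → k < m → IsThreshold m k (q k)

namespace IsThresholdSeq

variable {m : ℕ} {q : ℕ → ℝ}

lemma mem_Ioo (hq : IsThresholdSeq m q) {k : ℕ} (hk : 0 < k) (hkm : k < m) :
    q k ∈ Ioo (0 : ℝ) 1 :=
  (hq.isThreshold k hk hkm).1

lemma binomGap_eq_zero (hq : IsThresholdSeq m q) {k : ℕ} (hk : 0 < k) (hkm : k < m) :
    binomGap (m - 1) k (q k) = 0 :=
  ((isThreshold_iff hk _).1 (hq.isThreshold k hk hkm)).2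

lemma lt_succ (hq : IsThresholdSeq m q) {k : ℕ} (hkm : k < m) : q k < q (k + 1) := by
  rcases k.eq_zero_or_pos with rfl | hk
  · rw [hq.zero]
    rcases (Nat.succ_le_of_lt hkm).eq_or_lt with h | h
    · rw [show 0 + 1 = m from h, hq.last]
      exact one_pos
    · exact (hq.mem_Ioo one_pos h).1
  · rcases (Nat.succ_le_of_lt hkm).eq_or_lt with h | h
    · rw [show k + 1 = m from h, hq.last]
      exact (hq.mem_Ioo hk hkm).2
    · exact threshold_lt_succ hk (by omega) (hq.mem_Ioo hk hkm) (hq.mem_Ioo k.succ_pos h)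
        (hq.binomGap_eq_zero hk hkm) (hq.binomGap_eq_zero k.succ_pos h)

lemma le_of_le (hq : IsThresholdSeq m q) {k l : ℕ} (hkl : k ≤ l) (hlm : l ≤ m) : q k ≤ q l := by
  induction l, hkl using Nat.le_induction with
  | base => exact le_rfl
  | succ l hl ih => exact (ih (by omega)).trans (hq.lt_succ (by omega)).le

lemma mem_Ioc (hq : IsThresholdSeq m q) {k : ℕ} (hkm : k ≤ m) {p : ℝ}
    (hp : p ∈ Ioc (q (k - 1)) (q k)) : p ∈ Ioc (0 : ℝ) 1 := by
  have h0 := hq.le_of_le (Nat.zero_le (k - 1)) (by omega)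
  have h1 := hq.le_of_le hkm le_rfl
  rw [hq.zero] at h0
  rw [hq.last] at h1
  exact ⟨h0.trans_lt hp.1, hp.2.trans h1⟩

lemma mul_le (hq : IsThresholdSeq m q) {k : ℕ} (hk : 0 < k) (hkm : k ≤ m) :
    ((m - 1 : ℕ) + 1 : ℝ) * q k ≤ k := by
  rcases hkm.eq_or_lt with rfl | hkm
  · rw [hq.last, mul_one]
    exact_mod_cast (Nat.sub_add_cancel hk).le
  · exact threshold_mul_le hk (by omega) (hq.mem_Ioo hk hkm) (hq.binomGap_eq_zero hk hkm)

lemma binomGap_neg (hq : IsThresholdSeq m q) {k : ℕ} (hk : 0 < k) (hkm : k ≤ m) {p : ℝ}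
    (hp : 0 ≤ p) (hpk : p < q k) : binomGap (m - 1) k p < 0 := by
  rcases hkm.eq_or_lt with rfl | hkm
  · obtain ⟨n, rfl⟩ := Nat.exists_eq_succ_of_ne_zero hk.ne'
    rw [binomGap, Nat.succ_sub_one, Nat.succ_eq_add_one, binomSum_self_succ]
    simp [binomProb]
  · exact binomGap_neg_of_lt_threshold hk (by omega) (hq.mem_Ioo hk hkm)
      (hq.binomGap_eq_zero hk hkm) hp hpk

/-- Since `p` lies beyond the thresholds with index below `k` and not beyond the others, the gaps
are non-negative up to `k - 1` and non-positive from `k` on. -/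
lemma throughput_eq (hq : IsThresholdSeq m q) {k : ℕ} (hk : 0 < k) (hkm : k ≤ m) {p : ℝ}
    (hp : p ∈ Ioc (q (k - 1)) (q k)) :
    throughput m p = m * p / k * binomSum (m - 1) k p := by
  have hp01 := hq.mem_Ioc hkm hp
  refine throughput_eq_of_forall_binomSum_le hk hkm ⟨hp01.1.le, hp01.2⟩
    (le_of_unimodal (a := fun j : ℕ => binomSum (m - 1) j p / (j : ℝ)) (fun j hj hjk => ?_)
      fun j hkj hjm => ?_)
  · rw [← sub_nonneg, binomSum_div_succ_sub _ hj]
    refine div_nonneg (binomGap_nonneg_of_threshold_le hj (by omega) (hq.mem_Ioo hj (by omega))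
      (hq.binomGap_eq_zero hj (by omega)) ?_ hp01.2) (by positivity)
    exact (hq.le_of_le (by omega) (by omega)).trans hp.1.le
  · have hj : 0 < j := by omega
    rw [← sub_nonpos, binomSum_div_succ_sub _ hj]
    refine div_nonpos_of_nonpos_of_nonneg ?_ (by positivity)
    rcases (hp.2.trans (hq.le_of_le hkj hjm.le)).eq_or_lt with h | h
    · rw [h, hq.binomGap_eq_zero hj hjm]
    · exact (hq.binomGap_neg hj hjm.le hp01.1.le h).le

lemma eqOn_throughput (hq : IsThresholdSeq m q) {k : ℕ} (hk : 0 < k) (hkm : k ≤ m) :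
    EqOn (fun p => ((m : ℝ) / k) • (p * binomSum (m - 1) k p)) (throughput m)
      (Ioc (q (k - 1)) (q k)) := fun p hp => by
  rw [hq.throughput_eq hk hkm hp]
  simp only [smul_eq_mul]
  ring

lemma concaveOn_throughput (hq : IsThresholdSeq m q) {k : ℕ} (hk : 0 < k) (hkm : k ≤ m) :
    ConcaveOn ℝ (Ioc (q (k - 1)) (q k)) (throughput m) := by
  have h := concaveOn_mul_binomSum (n := m - 1) (k := k) (convex_Ioc (q (k - 1)) (q k))
    fun p hp => by
      have hp01 := hq.mem_Ioc hkm hp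
      refine ⟨⟨hp01.1.le, hp01.2⟩, ?_⟩
      have h1 := hq.mul_le hk hkm
      have h2 : ((m - 1 : ℕ) + 1 : ℝ) * p ≤ ((m - 1 : ℕ) + 1 : ℝ) * q k := by
        gcongr
        exact hp.2
      linarith
  exact (h.smul (by positivity : (0 : ℝ) ≤ m / k)).congr (hq.eqOn_throughput hk hkm)

lemma strictMonoOn_throughput (hq : IsThresholdSeq m q) {k : ℕ} (hk : 0 < k) (hkm : k ≤ m) :
    StrictMonoOn (throughput m) (Ioc (q (k - 1)) (q k)) := by
  have h : StrictMonoOn (fun p => p * binomSum (m - 1) k p) (Ioc (q (k - 1)) (q k)) := by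
    refine strictMonoOn_mul_binomSum (convex_Ioc _ _) fun p hp => ?_
    rw [interior_Ioc] at hp
    exact hq.binomGap_neg hk hkm (hq.mem_Ioc hkm ⟨hp.1, hp.2.le⟩).1.le hp.2
  have hm : 0 < m := by omega
  have hc : (0 : ℝ) < m / k := by positivity
  refine StrictMonoOn.congr (fun p hp p' hp' hlt => ?_) (hq.eqOn_throughput hk hkm)
  exact mul_lt_mul_of_pos_left (h hp hp' hlt) hc

end IsThresholdSeq

end BDRAC

theorem mainTheorem2 (m : ℕ) (hm : 2 ≤ m) :
    -- the thresholds are well defined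
    (∀ k : ℕ, 0 < k → k < m → ∃! x : ℝ, BDRAC.IsThreshold m k x) ∧
    ∀ q : ℕ → ℝ, q 0 = 0 → q m = 1 →
      (∀ k : ℕ, 0 < k → k < m → BDRAC.IsThreshold m k (q k)) →
      -- they partition the unit interval
      (∀ k : ℕ, k < m → q k < q (k + 1)) ∧
      -- location of the thresholds
      (q 1 = 1 / (m : ℝ) ∧
        q (m - 1) = 1 / (m : ℝ) ^ (1 / ((m : ℝ) - 1)) ∧
        ∀ k : ℕ, 2 ≤ k → k < m → q k ∈ Ioo (0 : ℝ) ((k : ℝ) / (m : ℝ))) ∧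
      -- the throughput is a maximum, and its value
      ((∀ p ∈ Icc (0 : ℝ) 1,
          IsGreatest (BDRAC.expectedSumRate p '' BDRAC.capacityRegion m)
            (BDRAC.throughput m p)) ∧
        ∀ k : ℕ, 1 ≤ k → k ≤ m → ∀ p ∈ Ioc (q (k - 1)) (q k),
          BDRAC.throughput m p
            = (m : ℝ) * p / (k : ℝ) * BDRAC.binomCDF (m - 1) (k - 1) p) ∧
      -- it is achieved by a single message per user, encoded at rate `1 / k`
      (∀ k : ℕ, 1 ≤ k → k ≤ m → ∀ p ∈ Ioc (q (k - 1)) (q k),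
        BDRAC.rateTuple (BDRAC.singleMessage m k) (BDRAC.singleRate m k (1 / (k : ℝ)))
            ∈ BDRAC.capacityRegionOf (BDRAC.singleMessage m k) ∧
          BDRAC.expectedSumRate p
              (BDRAC.rateTuple (BDRAC.singleMessage m k) (BDRAC.singleRate m k (1 / (k : ℝ))))
            = BDRAC.throughput m p) ∧
      -- regularity
      (ContinuousOn (BDRAC.throughput m) (Icc 0 1) ∧
        ∀ k : ℕ, 1 ≤ k → k ≤ m →
          ConcaveOn ℝ (Ioc (q (k - 1)) (q k)) (BDRAC.throughput m) ∧
            StrictMonoOn (BDRAC.throughput m) (Ioc (q (k - 1)) (q k))) := by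
  refine ⟨fun k hk hkm => BDRAC.existsUnique_isThreshold hk hkm, fun q hq0 hqm hqk => ?_⟩
  have hq : BDRAC.IsThresholdSeq m q := ⟨hq0, hqm, hqk⟩
  have hm0 : 0 < m := by omega
  have hm1 : ((m - 1 : ℕ) : ℝ) + 1 = m := by exact_mod_cast Nat.sub_add_cancel hm0
  have hmpos : (0 : ℝ) < m := by exact_mod_cast hm0
  refine ⟨fun k hkm => hq.lt_succ hkm, ⟨?_, ?_, fun k hk hkm => ?_⟩,
    ⟨fun p hp => BDRAC.isGreatest_throughput hm0 hp, fun k hk hkm p hp => ?_⟩,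
    fun k hk hkm p hp =>
      ⟨BDRAC.rateTuple_singleMessage_mem_capacityRegionOf m hk, ?_⟩,
    BDRAC.continuousOn_throughput hm0, fun k hk hkm =>
      ⟨hq.concaveOn_throughput hk hkm, hq.strictMonoOn_throughput hk hkm⟩⟩
  · have h := BDRAC.threshold_one (hq.mem_Ioo one_pos (by omega))
      (hq.binomGap_eq_zero one_pos (by omega))
    rw [hm1] at h
    rw [eq_div_iff hmpos.ne', mul_comm, h]
  · have hpos := (hq.mem_Ioo (k := m - 1) (by omega) (by omega)).1
    have h := BDRAC.threshold_self_pow (hq.binomGap_eq_zero (k := m - 1) (by omega) (by omega))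
    rw [hm1] at h
    -- At the last threshold, `(m - 1) b_{m-1} = S_{m-1} = 1 - b_{m-1}` with `b_{m-1} = p ^ (m -
    -- 1)`; it remains to take a root.
    have h1 : (m : ℝ) = (q (m - 1) ^ (m - 1))⁻¹ := eq_inv_of_mul_eq_one_left h
    have h2 : (m : ℝ) - 1 = (m - 1 : ℕ) := by linarith
    have h3 : (m : ℝ) ^ (1 / ((m : ℝ) - 1)) = (q (m - 1))⁻¹ := by
      rw [h2, one_div]
      conv_lhs => rw [h1]
      rw [← inv_pow, Real.pow_rpow_inv_natCast (inv_nonneg.2 hpos.le) (by omega)]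
    rw [h3, one_div, inv_inv]
  · have h := BDRAC.threshold_mul_lt hk (by omega) (hq.mem_Ioo (by omega) hkm)
      (hq.binomGap_eq_zero (by omega) hkm)
    rw [hm1] at h
    exact ⟨(hq.mem_Ioo (by omega) hkm).1, by rwa [lt_div_iff₀' hmpos]⟩
  · rw [hq.throughput_eq hk hkm hp, BDRAC.binomCDF_pred_eq_binomSum _ hk]
  · rw [hq.throughput_eq hk hkm hp, BDRAC.expectedSumRate_singleMessage hkm]
    ring
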